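/- Let $g>0$ be the gravitational acceleration, let $e_3=(0,0,1)^T$, and let $k_1^v,k_2^v,k_1^r>0$ be gains with $k_1^r\le k_1^v k_2^v/g$. Consider on $\mathbb{R}^3\times S^2$ the autonomous system (the error dynamics of $\gamma$-Observer 1) $$\dot{\bar v}=g(e_3-\bar\gamma)-k_1^v\bar v+k_2^v\,\bar\gamma\times(\bar\gamma\times\bar v),\qquad \dot{\bar\gamma}=-k_1^r\,\bar\gamma\times(\bar\gamma\times\bar v).$$ Then the following hold. 1. The system has exactly two equilibrium points, $(0,e_3)$ and $\left(\frac{2g}{k_1^v}e_3,-e_3\right)$, and both are isolated. For every initial condition $(\bar v(0),\bar\gamma(0))\in\mathbb{R}^3\times S^2$ there is a unique solution $(\bar v(t),\bar\gamma(t))$ on $[0,\infty)$, and it converges to one of these two equilibria as $t\to\infty$. 2. The equilibrium $(0,e_3)$ is almost globally asymptotically stable, i.e. it is asymptotically stable (Lyapunov stable and locally attractive) and the set of initial conditions whose solutions do not converge to it is a null set for the product of Lebesgue measure on $\mathbb{R}^3$ and surface measure on $S^2$. It is also locally exponentially stable, i.e. there are $r,C,a>0$ such that every solution starting at distance $d<r$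 from it is at distance at most $C\,d\,e^{-at}$ from it at every time $t\ge 0$. 3. The equilibrium $\left(\frac{2g}{k_1^v}e_3,-e_3\right)$ is unstable, i.e. not Lyapunov stable. -/

import Mathlib

open Filter Topology MeasureTheory Set

/-! Stability notions for a family `S` of forward trajectories `x : ℝ → X` (only the values at
times `t ≥ 0` matter) in a metric space `X`. -/

/-- Lyapunov stability of the point `p`. -/
def IsStablePt {X : Type*} [PseudoMetricSpace X] (S : Set (ℝ → X)) (p : X) : Prop :=
  ∀ ε > 0, ∃ δ > 0, ∀ x ∈ S, dist (x 0) p < δ → ∀ t, 0 ≤ t → dist (x t) p < ε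

/-- Instability: the negation of Lyapunov stability. -/
def IsUnstablePt {X : Type*} [PseudoMetricSpace X] (S : Set (ℝ → X)) (p : X) : Prop :=
  ¬ IsStablePt S p

/-- (Local) asymptotic stability: Lyapunov stability and local attractivity. -/
def IsAsymptoticallyStablePt {X : Type*} [PseudoMetricSpace X] (S : Set (ℝ → X)) (p : X) : Prop :=
  IsStablePt S p ∧ ∃ r > 0, ∀ x ∈ S, dist (x 0) p < r → Tendsto x atTop (𝓝 p)

/-- Almost global asymptotic stability: asymptotic stability, and trajectories converge to `p` from
all initial points outside a `μ`-null set. -/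
def IsAlmostGloballyAsymptoticallyStablePt {X : Type*} [PseudoMetricSpace X] [MeasurableSpace X]
    (μ : Measure X) (S : Set (ℝ → X)) (p : X) : Prop :=
  IsAsymptoticallyStablePt S p ∧ ∀ᵐ q ∂μ, ∀ x ∈ S, x 0 = q → Tendsto x atTop (𝓝 p)

/-- Local exponential stability. -/
def IsLocallyExponentiallyStablePt {X : Type*} [PseudoMetricSpace X]
    (S : Set (ℝ → X)) (p : X) : Prop :=
  ∃ r > 0, ∃ C > 0, ∃ a > 0, ∀ x ∈ S, dist (x 0) p < r →
    ∀ t, 0 ≤ t → dist (x t) p ≤ C * dist (x 0) p * Real.exp (-a * t)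

namespace GammaObserver

/-- Euclidean three-space. -/
abbrev E3 : Type := EuclideanSpace ℝ (Fin 3)

/-- The unit sphere in Euclidean three-space. -/
abbrev S2 : Type := Metric.sphere (0 : E3) 1

/-- The state space of the pairs of a velocity error and a direction error. -/
abbrev State : Type := E3 × S2

/-- The cross product on `E3`. -/
def cross (a b : E3) : E3 := WithLp.toLp 2 (crossProduct a.ofLp b.ofLp)

/-- The third vector of the canonical basis. -/
noncomputable def e3 : E3 := EuclideanSpace.single 2 1

/-- The third canonical basis vector as a point of the sphere. -/
noncomputable def north : S2 := ⟨e3, by simp [e3]⟩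

/-- The product of Lebesgue measure and the surface measure of the sphere. -/
noncomputable def stateMeasure : Measure State :=
  (volume : Measure E3).prod (volume : Measure E3).toSphere

/-- Velocity component of the error vector field. -/
noncomputable def fieldV (g k1v k2v : ℝ) (p : State) : E3 :=
  g • (e3 - (p.2 : E3)) - k1v • p.1 + k2v • cross p.2 (cross p.2 p.1)

/-- Direction component of the error vector field (tangent to the sphere at `p.2`). -/
noncomputable def fieldG (k1r : ℝ) (p : State) : E3 :=
  -(k1r • cross p.2 (cross p.2 p.1))

/-- Equilibria: the zeros of the vector field. -/
def IsEquilibrium (g k1v k2v k1r : ℝ) (p : State) : Prop :=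
  fieldV g k1v k2v p = 0 ∧ fieldG k1r p = 0

/-- The forward trajectories: the solutions on `[0, ∞)` with values in the state space. -/
def trajectories (g k1v k2v k1r : ℝ) : Set (ℝ → State) :=
  {x | ∀ t, 0 ≤ t →
    HasDerivWithinAt (fun s => (x s).1) (fieldV g k1v k2v (x t)) (Ici 0) t ∧
    HasDerivWithinAt (fun s => ((x s).2 : E3)) (fieldG k1r (x t)) (Ici 0) t}

/-- The equilibrium `(0, e₃)`. -/
noncomputable def goodEq : State := (0, north)

/-- The equilibrium `((2 g / k1v) e₃, -e₃)`. -/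
noncomputable def badEq (g k1v : ℝ) : State := ((2 * g / k1v) • e3, -north)

end GammaObserver

/-! In the coordinate `u = k1v • v - g • (e3 - γ)` the system becomes `u' = -k u - b s`, `γ' = κ s`,
where `s` is the part of `g e + u` tangent to the sphere at `γ`, and the gain condition says exactly
that `b ≥ 0`. Then `V = |u|² + B (1 - ⟪γ, e⟫)` with `B = 2 g (b + k) / κ` satisfies `V' ≤ -k (|u|² +
g² (1 - ⟪γ, e⟫²))` (`lyap_deriv_le`). The unstable equilibrium has energy `2 B`.

Once `V < 2 B`, the direction stays away from `-e`, so `V` decays exponentially and the trajectory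
tends to the good equilibrium (`lyap_le_exp`). If `V ≥ 2 B` forever, the excess `V - 2 B` decays
exponentially and dominates a multiple of `|u|²`, which forces convergence to the bad equilibrium
(`tendsto_of_le_lyap`). This gives the dichotomy without an invariance principle. Local exponential
stability follows because `V` is comparable to the squared distance, and instability because states
with `V < 2 B` lie arbitrarily close to the bad equilibrium.

The exceptional set is null by a cone argument instead of a stable manifold theorem. For two
trajectories near the bad equilibrium, `|δu|² - (B/2) |δγ|²` does not increase
(`exists_cone_deriv_nonpos`). If both converge there, it tends to `0`, hence was nonnegative: `δu`
controls `δγ`. Together with a backward Gronwall bound, this covers the exceptional set by countably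
many pieces, each a Lipschitz image of a subset of `ℝ³` inside a five-dimensional space
(`stateMeasure_tendsto_badEq`). -/

/-! ### Scalar differential inequalities and completeness of vector fields. -/

/-- Exponential comparison for a scalar differential inequality on `[t₀, ∞)`. -/
lemma le_mul_exp_of_deriv_le {f f' : ℝ → ℝ} {c t₀ : ℝ} (ht₀ : 0 ≤ t₀)
    (hf : ∀ t, 0 ≤ t → HasDerivWithinAt f (f' t) (Ici 0) t)
    (hle : ∀ t, t₀ ≤ t → f' t ≤ c * f t) {t : ℝ} (ht : t₀ ≤ t) :
    f t ≤ f t₀ * Real.exp (c * (t - t₀)) := by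
  have hexp : ∀ t, HasDerivAt (fun s => Real.exp (-c * (s - t₀)))
      (Real.exp (-c * (t - t₀)) * -c) t := fun t => by
    simpa using ((((hasDerivAt_id t).sub_const t₀).const_mul (-c)).exp)
  have hanti : AntitoneOn (fun s => f s * Real.exp (-c * (s - t₀))) (Ici t₀) := by
    apply antitoneOn_of_hasDerivWithinAt_nonpos (convex_Ici t₀)
      (f' := fun t => f' t * Real.exp (-c * (t - t₀)) + f t * (Real.exp (-c * (t - t₀)) * -c))
    · intro s hs
      have hs' : t₀ ≤ s := hs
      exact (((hf s (ht₀.trans hs')).continuousWithinAt).mono (Ici_subset_Ici.2 ht₀)).mul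
        (hexp s).continuousAt.continuousWithinAt
    · intro s hs
      rw [interior_Ici, mem_Ioi] at hs
      rw [interior_Ici]
      exact ((hf s (ht₀.trans hs.le)).mono (Ioi_subset_Ici ht₀)).mul (hexp s).hasDerivWithinAt
    · intro s hs
      rw [interior_Ici, mem_Ioi] at hs
      have := hle s hs.le
      have hpos := Real.exp_pos (-c * (s - t₀))
      nlinarith
  have h := hanti (mem_Ici.2 le_rfl) (mem_Ici.2 ht) ht
  simp only [sub_self, mul_zero, Real.exp_zero, mul_one] at h
  calc f t = f t * Real.exp (-c * (t - t₀)) * Real.exp (c * (t - t₀)) := by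
        rw [mul_assoc, ← Real.exp_add]; simp
    _ ≤ _ := by gcongr

lemma le_of_deriv_nonpos {f f' : ℝ → ℝ} {t₀ : ℝ} (ht₀ : 0 ≤ t₀)
    (hf : ∀ t, 0 ≤ t → HasDerivWithinAt f (f' t) (Ici 0) t)
    (hle : ∀ t, t₀ ≤ t → f' t ≤ 0) {t : ℝ} (ht : t₀ ≤ t) : f t ≤ f t₀ := by
  simpa using le_mul_exp_of_deriv_le (c := 0) ht₀ hf (by simpa using hle) ht

open scoped Manifold ContDiff in
/-- A `C¹` vector field of linear growth is complete. -/
lemma exists_forall_hasDerivAt_of_linear_growth {E : Type*} [NormedAddCommGroup E]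
    [NormedSpace ℝ E] [FiniteDimensional ℝ E] {f : E → E} (hf : ContDiff ℝ 1 f) {C : ℝ}
    (hC : ∀ x, ‖f x‖ ≤ C * (1 + ‖x‖)) (x : E) :
    ∃ α : ℝ → E, α 0 = x ∧ ∀ t, HasDerivAt α (f (α t)) t := by
  have : CompleteSpace E := FiniteDimensional.complete ℝ E
  have : ProperSpace E := FiniteDimensional.proper ℝ E
  set D : ℝ := max C 1
  have hD : 0 < D := lt_max_of_lt_right one_pos
  have hfD : ∀ x, ‖f x‖ ≤ D * (1 + ‖x‖) := fun x =>
    (hC x).trans (by gcongr; exact le_max_left _ _)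
  have key := exists_isMIntegralCurve_of_isMIntegralCurveOn (I := 𝓘(ℝ, E)) (M := E)
    (v := fun x => f x) (contMDiff_vectorSpace_iff_contDiff.2 hf)
    (ε := 1 / (2 * D)) (by positivity) ?_ x
  · obtain ⟨α, h0, hα⟩ := key
    refine ⟨α, h0, fun t => ?_⟩
    have h : HasFDerivAt α ((1 : ℝ →L[ℝ] ℝ).smulRight (f (α t))) t :=
      hasMFDerivAt_iff_hasFDerivAt.1 (hα t)
    exact h.hasDerivAt.congr_deriv (by simp)
  · intro x₀
    set ε : ℝ := 1 / (2 * D)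
    have hε : 0 < ε := by positivity
    -- On the ball of radius `1 + ‖x₀‖` about `x₀` the field is at most `2 D (1 + ‖x₀‖)`, so the
    -- existence time, radius over bound, is `1 / (2 D)` whatever `x₀` is. A uniform existence time
    -- gives global solutions.
    set a : NNReal := ⟨1 + ‖x₀‖, by positivity⟩
    have ha : (a : ℝ) = 1 + ‖x₀‖ := rfl
    set M : NNReal := ⟨2 * D * (1 + ‖x₀‖), by positivity⟩
    have hM : (M : ℝ) = 2 * D * (1 + ‖x₀‖) := rfl
    obtain ⟨K, hK⟩ := (hf.locallyLipschitz.locallyLipschitzOn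
      (s := Metric.closedBall x₀ a)).exists_lipschitzOnWith_of_compact
      (isCompact_closedBall x₀ a)
    have hPL : IsPicardLindelof (fun _ => f) (tmin := -ε) (tmax := ε)
        ⟨0, by constructor <;> linarith⟩ x₀ a 0 M K := by
      refine ⟨fun _ _ => hK, fun _ _ => continuousOn_const, fun _ _ y hy => ?_, ?_⟩
      · rw [mem_closedBall_iff_norm, ha] at hy
        have h1 : ‖y‖ ≤ ‖y - x₀‖ + ‖x₀‖ := by simpa using norm_add_le (y - x₀) x₀
        rw [hM]
        calc ‖f y‖ ≤ D * (1 + ‖y‖) := hfD y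
          _ ≤ D * (2 * (1 + ‖x₀‖)) := by gcongr; linarith
          _ = _ := by ring
      · rw [hM, ha]
        simp only [sub_zero, zero_sub, neg_neg, max_self, NNReal.coe_zero]
        simp only [ε]
        field_simp
        simp
    obtain ⟨α, h0, hα⟩ := hPL.exists_eq_forall_mem_Icc_hasDerivWithinAt₀
    refine ⟨α, h0, fun t ht => ?_⟩
    have h1 : HasDerivAt α (f (α t)) t := (hα t (Ioo_subset_Icc_self ht)).hasDerivAt
      (Icc_mem_nhds ht.1 ht.2)
    have h2 : HasFDerivAt α ((1 : ℝ →L[ℝ] ℝ).smulRight (f (α t))) t :=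
      h1.hasFDerivAt
    exact (hasMFDerivAt_iff_hasFDerivAt.2 h2).hasMFDerivWithinAt

/-! ### Null sets by Hausdorff dimension. -/

/-- Haar measure is a multiple of the Hausdorff measure of full dimension, which kills sets of
smaller dimension. -/
lemma volume_eq_zero_of_dimH_lt {E : Type*} [NormedAddCommGroup E] [NormedSpace ℝ E]
    [FiniteDimensional ℝ E] [MeasurableSpace E] [BorelSpace E] (μ : Measure E)
    [μ.IsAddHaarMeasure] {s : Set E} (hs : dimH s < Module.finrank ℝ E) : μ s = 0 := by
  have h0 : (Measure.hausdorffMeasure (Module.finrank ℝ E : ℝ) : Measure E) s = 0 := by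
    simpa using hausdorffMeasure_of_dimH_lt (d := (Module.finrank ℝ E : NNReal)) (by simpa using hs)
  rw [Measure.isAddLeftInvariant_eq_smul μ
    (Measure.hausdorffMeasure (Module.finrank ℝ E : ℝ) : Measure E)]
  simp [h0]

namespace GammaObserver

/-- A subset of the state space with a map to `ℝ³` whose inverse is Lipschitz is a null set: it has
positive codimension. -/
lemma stateMeasure_eq_zero_of_dist_le {T : Set State} (Φ : State → E3) (K : NNReal)
    (hΦ : ∀ p ∈ T, ∀ q ∈ T, dist p q ≤ K * dist (Φ p) (Φ q)) : stateMeasure T = 0 := by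
  rcases T.eq_empty_or_nonempty with rfl | hT
  · simp
  have : Nonempty State := ⟨goodEq⟩
  let ι : State → E3 × E3 := fun p => (p.1, (p.2 : E3))
  have hι : Continuous ι := by fun_prop
  have hinv : ∀ p ∈ T, Function.invFunOn Φ T (Φ p) ∈ T ∧
      Φ (Function.invFunOn Φ T (Φ p)) = Φ p := fun p hp =>
    ⟨Function.invFunOn_mem ⟨p, hp, rfl⟩, Function.invFunOn_eq ⟨p, hp, rfl⟩⟩
  have hF : LipschitzOnWith K (fun y => ι (Function.invFunOn Φ T y)) (Φ '' T) := by
    apply LipschitzOnWith.of_dist_le_mul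
    rintro _ ⟨p, hp, rfl⟩ _ ⟨q, hq, rfl⟩
    have h := hΦ _ (hinv p hp).1 _ (hinv q hq).1
    rw [(hinv p hp).2, (hinv q hq).2] at h
    exact h
  obtain ⟨G, hG, hGF⟩ := hF.extend_finite_dimension
  -- `T` itself need not be measurable. The range of the extension `G` is a countable union of
  -- compact sets, so `T'` is a measurable set containing `T`.
  set T' : Set State := ι ⁻¹' range G
  have hTT' : T ⊆ T' := by
    intro p hp
    refine ⟨Φ p, ?_⟩
    rw [← hGF ⟨p, hp, rfl⟩]
    have h1 := hΦ _ (hinv p hp).1 _ hp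
    rw [(hinv p hp).2, dist_self, mul_zero] at h1
    simp only [dist_le_zero.1 h1]
  have hmeas : MeasurableSet T' := by
    refine hι.measurable ?_
    rw [← image_univ, ← Metric.iUnion_closedBall_nat (0 : E3), image_iUnion]
    exact MeasurableSet.iUnion fun n =>
      ((isCompact_closedBall (0 : E3) n).image hG.continuous).isClosed.measurableSet
  -- Surface measure is defined through the volume of cones, so the sphere component is multiplied
  -- by a radius. This adds one dimension: at most `3 + 1 = 4`, still below `6`.
  set S : Set (E3 × E3) := (fun q : (E3 × E3) × ℝ => (q.1.1, q.2 • q.1.2)) ''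
    range (fun y : E3 × ℝ => (G y.1, y.2))
  have hdim : dimH S ≤ 4 := by
    have h1 : dimH S ≤ dimH (range (fun y : E3 × ℝ => (G y.1, y.2))) :=
      ContDiffOn.dimH_image_le (s := univ) (ContDiff.contDiffOn (by fun_prop)) convex_univ
        (subset_univ _)
    have h2 : LipschitzWith _ (fun y : E3 × ℝ => (G y.1, y.2)) :=
      (hG.comp LipschitzWith.prod_fst).prodMk LipschitzWith.prod_snd
    have h3 := h2.dimH_range_le
    rw [Real.dimH_univ_eq_finrank] at h3
    refine (h1.trans h3).trans ?_
    simp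
  have hS0 : ((volume : Measure E3).prod (volume : Measure E3)) S = 0 := by
    apply volume_eq_zero_of_dimH_lt
    refine hdim.trans_lt ?_
    simp
    norm_num
  refine measure_mono_null hTT' ?_
  rw [stateMeasure, Measure.measure_prod_null hmeas]
  filter_upwards [Measure.measure_ae_null_of_prod_null hS0] with v hv
  simp only [Pi.zero_apply] at hv ⊢
  rw [Measure.toSphere_apply' _ (measurable_prodMk_left hmeas)]
  rw [measure_mono_null ?_ hv, mul_zero]
  rintro _ ⟨r, -, _, ⟨γ, hγ, rfl⟩, rfl⟩
  obtain ⟨y, hy⟩ := hγ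
  refine ⟨(G y, r), ⟨(y, r), rfl⟩, ?_⟩
  simp [hy, ι]

end GammaObserver

/-! ### The flow in decoupled coordinates and its Lyapunov function. -/

section SphereFlow

open scoped RealInnerProductSpace

variable {E : Type*} [NormedAddCommGroup E] [InnerProductSpace ℝ E]

/-- The component of `g • e + u` orthogonal to the unit vector `γ`. -/
def slip (g : ℝ) (e γ u : E) : E := (g • e + u) - ⟪γ, g • e + u⟫ • γ

/-- The error dynamics in the coordinates `u = k v - g (e - γ)`, where they are decoupled up to the
common forcing term `slip`. -/
structure IsSphereFlow (g k b κ : ℝ) (e : E) (u γ : ℝ → E) : Prop where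
  norm_eq : ∀ t, 0 ≤ t → ‖γ t‖ = 1
  deriv_fst : ∀ t, 0 ≤ t →
    HasDerivWithinAt u (-(k • u t) - b • slip g e (γ t) (u t)) (Ici 0) t
  deriv_snd : ∀ t, 0 ≤ t → HasDerivWithinAt γ (κ • slip g e (γ t) (u t)) (Ici 0) t

variable {g k b κ : ℝ} {e : E} {u γ : ℝ → E}

/-- The Lyapunov function. -/
noncomputable def lyap (g k b κ : ℝ) (e u γ : E) : ℝ :=
  ⟪u, u⟫ + 2 * g * (b + k) / κ * (1 - ⟪γ, e⟫)

lemma inner_self_of_norm_one {x : E} (hx : ‖x‖ = 1) : ⟪x, x⟫ = 1 := by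
  rw [real_inner_self_eq_norm_sq, hx, one_pow]

lemma inner_mem_Icc_of_norm_one {x y : E} (hx : ‖x‖ = 1) (hy : ‖y‖ = 1) :
    -1 ≤ ⟪x, y⟫ ∧ ⟪x, y⟫ ≤ 1 := by
  have := abs_real_inner_le_norm x y
  rw [hx, hy, one_mul] at this
  exact abs_le.1 this

lemma inner_slip_self (he : ‖e‖ = 1) {x : E} (hx : ‖x‖ = 1) (g : ℝ) (y : E) :
    ⟪slip g e x y, slip g e x y⟫ = g ^ 2 * (1 - ⟪x, e⟫ ^ 2) +
      2 * g * (⟪y, e⟫ - ⟪x, y⟫ * ⟪x, e⟫) + (⟪y, y⟫ - ⟪x, y⟫ ^ 2) := by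
  simp only [slip, inner_sub_left, inner_sub_right, inner_add_left, inner_add_right,
    real_inner_smul_left, real_inner_smul_right, inner_self_of_norm_one he,
    inner_self_of_norm_one hx, real_inner_comm e y, real_inner_comm x y, real_inner_comm x e]
  ring

lemma inner_slip_right (e x : E) (g : ℝ) (y : E) :
    ⟪y, slip g e x y⟫ = g * (⟪y, e⟫ - ⟪x, y⟫ * ⟪x, e⟫) + (⟪y, y⟫ - ⟪x, y⟫ ^ 2) := by
  simp only [slip, inner_sub_right, inner_add_right, real_inner_smul_right, real_inner_comm x y]
  ring

lemma inner_slip_left_const (he : ‖e‖ = 1) (x : E) (g : ℝ) (y : E) :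
    ⟪slip g e x y, e⟫ = g * (1 - ⟪x, e⟫ ^ 2) + (⟪y, e⟫ - ⟪x, y⟫ * ⟪x, e⟫) := by
  simp only [slip, inner_sub_left, inner_add_left, inner_add_right,
    real_inner_smul_left, real_inner_smul_right, inner_self_of_norm_one he]
  ring

/-- The derivative of the Lyapunov function along the flow. -/
lemma lyap_deriv_le (hk : 0 ≤ k) (hb : 0 ≤ b) (hκ : 0 < κ) (he : ‖e‖ = 1) {x : E}
    (hx : ‖x‖ = 1) (y : E) :
    2 * ⟪y, -(k • y) - b • slip g e x y⟫
      - 2 * g * (b + k) / κ * ⟪κ • slip g e x y, e⟫ ≤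
        -(k * (⟪y, y⟫ + g ^ 2 * (1 - ⟪x, e⟫ ^ 2))) := by
  have h1 : 0 ≤ ⟪slip g e x y, slip g e x y⟫ := real_inner_self_nonneg
  rw [inner_slip_self he hx] at h1
  rw [inner_sub_right, inner_neg_right, real_inner_smul_right, real_inner_smul_right,
    real_inner_smul_left, inner_slip_right, inner_slip_left_const he]
  set X := ⟪y, e⟫ - ⟪x, y⟫ * ⟪x, e⟫
  set Q := 1 - ⟪x, e⟫ ^ 2
  have e1 : 2 * g * (b + k) / κ * (κ * (g * Q + X)) = 2 * g * (b + k) * (g * Q + X) := by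
    field_simp
  rw [e1]
  -- The left side equals `-(2 b + k) |slip|² - k ⟪x, y⟫² - k (|y|² + g² Q)`: the weight `2 g (b +
  -- k) / κ` is the one for which the mixed terms complete to squares.
  nlinarith [mul_nonneg hb h1, mul_nonneg hk h1, mul_nonneg hk (sq_nonneg ⟪x, y⟫)]

namespace IsSphereFlow

variable (h : IsSphereFlow g k b κ e u γ)
include h

lemma hasDerivWithinAt_inner_self {t : ℝ} (ht : 0 ≤ t) :
    HasDerivWithinAt (fun s => ⟪u s, u s⟫)
      (2 * ⟪u t, -(k • u t) - b • slip g e (γ t) (u t)⟫) (Ici 0) t := by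
  refine ((h.deriv_fst t ht).inner ℝ (h.deriv_fst t ht)).congr_deriv ?_
  rw [real_inner_comm (u t)]
  ring

lemma hasDerivWithinAt_lyap {t : ℝ} (ht : 0 ≤ t) :
    HasDerivWithinAt (fun s => lyap g k b κ e (u s) (γ s))
      (2 * ⟪u t, -(k • u t) - b • slip g e (γ t) (u t)⟫
        - 2 * g * (b + k) / κ * ⟪κ • slip g e (γ t) (u t), e⟫) (Ici 0) t := by
  have h1 := ((h.deriv_snd t ht).inner ℝ (hasDerivWithinAt_const t (Ici 0) e))
  refine ((h.hasDerivWithinAt_inner_self ht).add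
    ((h1.const_sub 1).const_mul (2 * g * (b + k) / κ))).congr_deriv ?_
  rw [inner_zero_right]
  ring

lemma lyap_antitone (hk : 0 ≤ k) (hb : 0 ≤ b) (hκ : 0 < κ) (he : ‖e‖ = 1) {s t : ℝ}
    (hs : 0 ≤ s) (hst : s ≤ t) :
    lyap g k b κ e (u t) (γ t) ≤ lyap g k b κ e (u s) (γ s) := by
  refine le_of_deriv_nonpos (f := fun s => lyap g k b κ e (u s) (γ s)) hs
    (fun r hr => h.hasDerivWithinAt_lyap hr) (fun r hr => ?_) hst
  have hx := h.norm_eq r (hs.trans hr)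
  refine (lyap_deriv_le hk hb hκ he hx _).trans ?_
  have hz := inner_mem_Icc_of_norm_one hx he
  have : 0 ≤ 1 - ⟪γ r, e⟫ ^ 2 := by nlinarith
  have := real_inner_self_nonneg (x := u r)
  rw [neg_nonpos]
  positivity

/-- Exponential decay of the Lyapunov function below the level of the unstable equilibrium. -/
lemma lyap_le_exp (hg : 0 < g) (hk : 0 < k) (hb : 0 ≤ b) (hκ : 0 < κ) (he : ‖e‖ = 1) {η t₀ : ℝ}
    (ht₀ : 0 ≤ t₀)
    (hL : lyap g k b κ e (u t₀) (γ t₀) ≤ 2 * g * (b + k) / κ * (2 - η)) {t : ℝ}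
    (ht : t₀ ≤ t) :
    lyap g k b κ e (u t) (γ t) ≤ lyap g k b κ e (u t₀) (γ t₀) *
      Real.exp (-(k * min 1 (g ^ 2 * η / (2 * g * (b + k) / κ))) * (t - t₀)) := by
  refine le_mul_exp_of_deriv_le (f := fun s => lyap g k b κ e (u s) (γ s)) ht₀
    (fun r hr => h.hasDerivWithinAt_lyap hr) (fun r hr => ?_) ht
  have hx := h.norm_eq r (ht₀.trans hr)
  refine (lyap_deriv_le hk.le hb hκ he hx _).trans ?_
  have hz := inner_mem_Icc_of_norm_one hx he
  have hV := (h.lyap_antitone hk.le hb hκ he ht₀ hr).trans hL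
  have hU := real_inner_self_nonneg (x := u r)
  unfold lyap at hV ⊢
  set B := 2 * g * (b + k) / κ
  have hB : 0 < B := by positivity
  set z := ⟪γ r, e⟫
  set U := ⟪u r, u r⟫
  -- The energy bound keeps `γ` away from `-e`, so `1 - z² ≥ η (1 - z)` and the dissipation
  -- dominates a multiple of the energy itself.
  have hz1 : η ≤ 1 + z := by
    have : B * (1 - z) ≤ B * (2 - η) := by linarith
    linarith [le_of_mul_le_mul_left this hB]
  set m := min 1 (g ^ 2 * η / B)
  have hm1 : m ≤ 1 := min_le_left _ _
  have hm2 : m * B ≤ g ^ 2 * η := (le_div_iff₀ hB).1 (min_le_right _ _)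
  have h1 : m * B * (1 - z) ≤ g ^ 2 * η * (1 - z) := by gcongr; linarith
  have h2 : g ^ 2 * η * (1 - z) ≤ g ^ 2 * (1 + z) * (1 - z) := by gcongr; linarith
  have h3 : m * U ≤ U := by nlinarith
  have h4 : m * (U + B * (1 - z)) ≤ U + g ^ 2 * (1 - z ^ 2) := by nlinarith
  have := mul_le_mul_of_nonneg_left h4 hk.le
  linarith

/-- A trajectory that never gets below the level of the unstable equilibrium converges to it. -/
lemma tendsto_of_le_lyap (hg : 0 < g) (hk : 0 < k) (hb : 0 ≤ b) (hκ : 0 < κ) (he : ‖e‖ = 1)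
    (hL : ∀ t, 0 ≤ t → 2 * (2 * g * (b + k) / κ) ≤ lyap g k b κ e (u t) (γ t)) :
    Tendsto (fun t => ⟪u t, u t⟫) atTop (𝓝 0) ∧ Tendsto (fun t => ⟪γ t, e⟫) atTop (𝓝 (-1)) := by
  set B := 2 * g * (b + k) / κ with hBdef
  have hB : 0 < B := by positivity
  set Y : ℝ → ℝ := fun t => lyap g k b κ e (u t) (γ t) - 2 * B
  have hYU : ∀ t, Y t = ⟪u t, u t⟫ - B * (1 + ⟪γ t, e⟫) := fun t => by
    simp only [Y, lyap, ← hBdef]; ring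
  have hY0 : ∀ t, 0 ≤ t → 0 ≤ Y t := fun t ht => sub_nonneg.2 (hL t ht)
  have hU0 : ∀ t, 0 ≤ ⟪u t, u t⟫ := fun t => real_inner_self_nonneg
  have hYd := fun t (ht : 0 ≤ t) => (h.hasDerivWithinAt_lyap ht).sub_const (2 * B)
  have hz := fun t (ht : 0 ≤ t) => inner_mem_Icc_of_norm_one (h.norm_eq t ht) he
  have hQ0 : ∀ t, 0 ≤ t → 0 ≤ 1 - ⟪γ t, e⟫ ^ 2 := fun t ht => by nlinarith [hz t ht]
  have hYd' : ∀ t, 0 ≤ t → 2 * ⟪u t, -(k • u t) - b • slip g e (γ t) (u t)⟫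
      - 2 * g * (b + k) / κ * ⟪κ • slip g e (γ t) (u t), e⟫ ≤ -(k * ⟪u t, u t⟫) := by
    intro t ht
    refine (lyap_deriv_le hk.le hb hκ he (h.norm_eq t ht) _).trans ?_
    have := hQ0 t ht
    have : 0 ≤ g ^ 2 * (1 - ⟪γ t, e⟫ ^ 2) := by positivity
    nlinarith
  set K := 2 * k + 2 * b * (g * (1 + 2 / B) / 2 + 1)
  have hK : 0 < K := by positivity
  -- `|u|²` cannot decay faster than exponentially: nonnegativity of the excess `Y` bounds `1 - ⟪γ,
  -- e⟫² ≤ 2 (1 + ⟪γ, e⟫)` by a multiple of `|u|²`, so the forcing is controlled by `|u|²` too.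
  have hUd : ∀ t, 0 ≤ t →
      -(K * ⟪u t, u t⟫) ≤ 2 * ⟪u t, -(k • u t) - b • slip g e (γ t) (u t)⟫ := by
    intro t ht
    have hx := h.norm_eq t ht
    rw [inner_sub_right, inner_neg_right, real_inner_smul_right, real_inner_smul_right,
      inner_slip_right]
    -- With `-1` in place of `g`, positivity of the square bounds the mixed term: `2 X ≤ (1 - ⟪γ,
    -- e⟫²) + |u|² - ⟪γ, u⟫²`.
    have h1 : 0 ≤ ⟪slip (-1) e (γ t) (u t), slip (-1) e (γ t) (u t)⟫ := real_inner_self_nonneg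
    rw [inner_slip_self he hx] at h1
    have h2 : 1 - ⟪γ t, e⟫ ^ 2 ≤ 2 / B * ⟪u t, u t⟫ := by
      have h3 := hY0 t ht
      rw [hYU] at h3
      have h4 : 1 + ⟪γ t, e⟫ ≤ ⟪u t, u t⟫ / B := by
        rw [le_div_iff₀ hB]; linarith
      have h5 : 2 / B * ⟪u t, u t⟫ = 2 * (⟪u t, u t⟫ / B) := by ring
      nlinarith [hz t ht]
    set X := ⟪u t, e⟫ - ⟪γ t, u t⟫ * ⟪γ t, e⟫
    have h3 : X ≤ (⟪u t, u t⟫ * (1 + 2 / B)) / 2 := by nlinarith [sq_nonneg ⟪γ t, u t⟫]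
    have h4 : g * X + (⟪u t, u t⟫ - ⟪γ t, u t⟫ ^ 2) ≤
        (g * (1 + 2 / B) / 2 + 1) * ⟪u t, u t⟫ := by
      nlinarith [sq_nonneg ⟪γ t, u t⟫]
    have := mul_le_mul_of_nonneg_left h4 hb
    simp only [K]
    linarith
  have hYlim : Tendsto Y atTop (𝓝 0) := by
    have hb1 : ∀ t, 0 ≤ t → Y t ≤ Y 0 * Real.exp (-k * t) := by
      intro t ht
      have := le_mul_exp_of_deriv_le (f := Y) (c := -k) le_rfl hYd (fun r hr => ?_) ht
      · rwa [sub_zero] at this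
      · refine (hYd' r hr).trans ?_
        rw [hYU]
        have h2 : 0 ≤ B * (1 + ⟪γ r, e⟫) := mul_nonneg hB.le (by linarith [hz r hr])
        nlinarith
    have hexp : Tendsto (fun t => Y 0 * Real.exp (-k * t)) atTop (𝓝 0) := by
      have := (Real.tendsto_exp_atBot.comp
        (tendsto_id.const_mul_atTop_of_neg (neg_neg_of_pos hk))).const_mul (Y 0)
      rwa [mul_zero] at this
    refine tendsto_of_tendsto_of_tendsto_of_le_of_le' tendsto_const_nhds hexp ?_ ?_
    · filter_upwards [eventually_ge_atTop 0] with t ht using hY0 t ht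
    · filter_upwards [eventually_ge_atTop 0] with t ht using hb1 t ht
  -- `Y - (k / K) |u|²` is nonincreasing. Were it ever negative, `|u|²` would stay bounded below
  -- from then on, so `Y` would decrease at least linearly and violate `Y ≥ 0`.
  have hZ : ∀ t, 0 ≤ t → k / K * ⟪u t, u t⟫ ≤ Y t := by
    intro t₀ ht₀
    by_contra! hneg
    set c := k / K * ⟪u t₀, u t₀⟫ - Y t₀
    have hc : 0 < c := sub_pos.2 hneg
    have hmono : ∀ t, t₀ ≤ t → c ≤ k / K * ⟪u t, u t⟫ := by
      intro t ht
      have := le_of_deriv_nonpos ht₀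
        (fun r hr => (hYd r hr).sub ((h.hasDerivWithinAt_inner_self hr).const_mul (k / K)))
        (fun r hr => ?_) ht
      · simp only [Pi.sub_apply] at this
        linarith [hY0 t (ht₀.trans ht)]
      · have h1 := hYd' r (ht₀.trans hr)
        have h2 := mul_le_mul_of_nonneg_left (hUd r (ht₀.trans hr)) (div_pos hk hK).le
        have h3 : k / K * -(K * ⟪u r, u r⟫) = -(k * ⟪u r, u r⟫) := by field_simp
        linarith
    have hdec : ∀ t, t₀ ≤ t → Y t + K * c * t ≤ Y t₀ + K * c * t₀ := by
      intro t ht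
      refine le_of_deriv_nonpos (f := fun t => Y t + K * c * t) ht₀
        (fun r hr => (hYd r hr).add ((hasDerivWithinAt_id r _).const_mul (K * c)))
        (fun r hr => ?_) ht
      have h1 := hYd' r (ht₀.trans hr)
      have h2 := mul_le_mul_of_nonneg_left (hmono r hr) hK.le
      have h3 : K * (k / K * ⟪u r, u r⟫) = k * ⟪u r, u r⟫ := by field_simp
      linarith
    set t₁ := t₀ + (Y t₀ + 1) / (K * c)
    have hY00 := hY0 t₀ ht₀
    have ht₁ : t₀ ≤ t₁ := le_add_of_nonneg_right (by positivity)
    have h1 := hdec t₁ ht₁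
    have h2 := hY0 t₁ (ht₀.trans ht₁)
    have h3 : K * c * t₁ = K * c * t₀ + (Y t₀ + 1) := by
      simp only [t₁]; field_simp
    linarith
  have hUlim : Tendsto (fun t => ⟪u t, u t⟫) atTop (𝓝 0) := by
    have h1 : Tendsto (fun t => K / k * Y t) atTop (𝓝 0) := by
      simpa using hYlim.const_mul (K / k)
    refine tendsto_of_tendsto_of_tendsto_of_le_of_le' tendsto_const_nhds h1
      (Eventually.of_forall hU0) ?_
    filter_upwards [eventually_ge_atTop 0] with t ht
    have h2 := mul_le_mul_of_nonneg_left (hZ t ht) (div_pos hK hk).le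
    have h3 : K / k * (k / K * ⟪u t, u t⟫) = ⟪u t, u t⟫ := by field_simp
    linarith
  refine ⟨hUlim, ?_⟩
  have h1 : Tendsto (fun t => (⟪u t, u t⟫ - Y t) / B - 1) atTop (𝓝 (-1)) := by
    simpa using ((hUlim.sub hYlim).div_const B).sub_const 1
  refine h1.congr fun t => ?_
  rw [hYU]
  field_simp
  ring

end IsSphereFlow

end SphereFlow

/-! ### Differences of two trajectories, the cone condition and global existence. -/

section SphereFlow

open scoped RealInnerProductSpace

variable {E : Type*} [NormedAddCommGroup E] [InnerProductSpace ℝ E] {g k b κ : ℝ} {e : E}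

/-- This form exposes the linearization at the unstable equilibrium: near it the coefficient of `x₁
- x₂` is close to `g`, and the last term is small compared with `‖x₁ - x₂‖`. -/
lemma slip_sub_slip (g : ℝ) (e x₁ y₁ x₂ y₂ : E) :
    slip g e x₁ y₁ - slip g e x₂ y₂ = (y₁ - y₂) - ⟪x₂, y₁ - y₂⟫ • x₂
      - ⟪x₁, g • e + y₁⟫ • (x₁ - x₂) - ⟪x₁ - x₂, g • e + y₁⟫ • x₂ := by
  have h1 : ⟪x₂, y₁ - y₂⟫ = ⟪x₂, g • e + y₁⟫ - ⟪x₂, g • e + y₂⟫ := by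
    rw [← inner_sub_right]; congr 1; abel
  rw [h1, inner_sub_left x₁]
  simp only [slip]
  module

lemma norm_slip_sub_slip_le (he : ‖e‖ = 1) {x₁ x₂ y₁ y₂ : E} (hx₁ : ‖x₁‖ = 1) (hx₂ : ‖x₂‖ = 1)
    (hg : 0 ≤ g) {R : ℝ} (hy₁ : ‖y₁‖ ≤ R) :
    ‖slip g e x₁ y₁ - slip g e x₂ y₂‖ ≤ 2 * ‖y₁ - y₂‖ + 2 * (g + R) * ‖x₁ - x₂‖ := by
  have hw : ‖g • e + y₁‖ ≤ g + R := by
    refine (norm_add_le _ _).trans ?_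
    rw [norm_smul, he, mul_one, Real.norm_of_nonneg hg]
    linarith
  have h1 : ‖⟪x₂, y₁ - y₂⟫ • x₂‖ ≤ ‖y₁ - y₂‖ := by
    rw [norm_smul, hx₂, mul_one]
    simpa [hx₂] using norm_inner_le_norm (𝕜 := ℝ) x₂ (y₁ - y₂)
  have h2 : ‖⟪x₁, g • e + y₁⟫ • (x₁ - x₂)‖ ≤ (g + R) * ‖x₁ - x₂‖ := by
    rw [norm_smul]
    gcongr
    refine (norm_inner_le_norm (𝕜 := ℝ) x₁ _).trans ?_
    rwa [hx₁, one_mul]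
  have h3 : ‖⟪x₁ - x₂, g • e + y₁⟫ • x₂‖ ≤ (g + R) * ‖x₁ - x₂‖ := by
    rw [norm_smul, hx₂, mul_one]
    refine (norm_inner_le_norm (𝕜 := ℝ) _ _).trans ?_
    rw [mul_comm]
    gcongr
  rw [slip_sub_slip]
  calc _ ≤ ‖y₁ - y₂‖ + ‖⟪x₂, y₁ - y₂⟫ • x₂‖ + ‖⟪x₁, g • e + y₁⟫ • (x₁ - x₂)‖
        + ‖⟪x₁ - x₂, g • e + y₁⟫ • x₂‖ :=
        (norm_sub_le _ _).trans (add_le_add_left ((norm_sub_le _ _).trans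
          (add_le_add_left (norm_sub_le _ _) _)) _)
    _ ≤ _ := by linarith

/-- Two-sided bound for the derivative of the squared distance of two trajectories. -/
lemma abs_deriv_sq_dist_le (he : ‖e‖ = 1) (hg : 0 ≤ g) (hk : 0 ≤ k) (hb : 0 ≤ b) (hκ : 0 ≤ κ)
    {x₁ x₂ y₁ y₂ : E} (hx₁ : ‖x₁‖ = 1) (hx₂ : ‖x₂‖ = 1) {R : ℝ} (hy₁ : ‖y₁‖ ≤ R) :
    |2 * ⟪y₁ - y₂, -(k • (y₁ - y₂)) - b • (slip g e x₁ y₁ - slip g e x₂ y₂)⟫ +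
      2 * ⟪x₁ - x₂, κ • (slip g e x₁ y₁ - slip g e x₂ y₂)⟫| ≤
      (2 * k + 8 * (b + κ) * (1 + (g + R))) *
        (⟪y₁ - y₂, y₁ - y₂⟫ + ⟪x₁ - x₂, x₁ - x₂⟫) := by
  have hs := norm_slip_sub_slip_le he hx₁ hx₂ hg hy₁ (y₂ := y₂)
  have hR : 0 ≤ R := (norm_nonneg _).trans hy₁
  set s := slip g e x₁ y₁ - slip g e x₂ y₂
  set y := y₁ - y₂
  set x := x₁ - x₂
  have h1 := abs_real_inner_le_norm y s
  have h2 := abs_real_inner_le_norm x s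
  rw [inner_sub_right, inner_neg_right, real_inner_smul_right, real_inner_smul_right,
    real_inner_smul_right, real_inner_self_eq_norm_sq, real_inner_self_eq_norm_sq]
  have e1 : 2 * (-(k * ‖y‖ ^ 2) - b * ⟪y, s⟫) + 2 * (κ * ⟪x, s⟫) =
    -(2 * k * ‖y‖ ^ 2) + (-(2 * b * ⟪y, s⟫) + 2 * κ * ⟪x, s⟫) := by ring
  rw [e1]
  have hy0 := norm_nonneg y
  have hx0 := norm_nonneg x
  have hs' : ‖s‖ ≤ 2 * (1 + (g + R)) * (‖y‖ + ‖x‖) := by nlinarith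
  calc _ ≤ |-(2 * k * ‖y‖ ^ 2)| + (|-(2 * b * ⟪y, s⟫)| + |2 * κ * ⟪x, s⟫|) :=
        (abs_add_le _ _).trans (add_le_add_right (abs_add_le _ _) _)
    _ = 2 * k * ‖y‖ ^ 2 + (2 * b * |⟪y, s⟫| + 2 * κ * |⟪x, s⟫|) := by
        rw [abs_neg, abs_neg, abs_mul (2 * b), abs_mul (2 * κ), abs_of_nonneg (by positivity),
          abs_of_nonneg (by positivity : 0 ≤ 2 * b), abs_of_nonneg (by positivity : 0 ≤ 2 * κ)]
    _ ≤ 2 * k * ‖y‖ ^ 2 + (2 * b * (‖y‖ * ‖s‖) + 2 * κ * (‖x‖ * ‖s‖)) := by gcongr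
    _ ≤ 2 * k * ‖y‖ ^ 2 + 2 * ((b + κ) * (‖y‖ + ‖x‖)) * ‖s‖ := by
        have : 0 ≤ (b * ‖x‖ + κ * ‖y‖) * ‖s‖ := by positivity
        nlinarith
    _ ≤ 2 * k * ‖y‖ ^ 2 + 2 * ((b + κ) * (‖y‖ + ‖x‖)) * (2 * (1 + (g + R)) * (‖y‖ + ‖x‖)) := by
        gcongr
    _ = 2 * k * ‖y‖ ^ 2 + 4 * (b + κ) * (1 + (g + R)) * (‖y‖ + ‖x‖) ^ 2 := by ring
    _ ≤ 2 * k * (‖y‖ ^ 2 + ‖x‖ ^ 2) +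
        4 * (b + κ) * (1 + (g + R)) * (2 * (‖y‖ ^ 2 + ‖x‖ ^ 2)) := by
        gcongr
        · nlinarith
        · nlinarith [sq_nonneg (‖y‖ - ‖x‖)]
    _ = _ := by ring

/-- The scalar estimate behind the monotonicity of the cone form. -/
lemma cone_form_nonpos {g k b ε a c d h l r₁ r₂ : ℝ} (hg : 0 < g) (hk : 0 < k) (hb : 0 ≤ b)
    (hε : 0 < ε)
    (hεM : 2 * (ε * (2 * g * (b + k) + 4 * b * (g + 1) + 4 * g * (b + k) * (g + 1))) =
      k * min 1 (g ^ 2))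
    (sq1 : 0 ≤ c ^ 2 - h ^ 2 + 2 * g * (d - h * l) + g ^ 2 * a ^ 2)
    (sq2 : 0 ≤ c ^ 2 + 2 * g * d + g ^ 2 * a ^ 2)
    (hhl : |h * l| ≤ ε * (a * c)) (hr₁ : |r₁| ≤ 2 * (g + 1) * ε * (a * c))
    (hr₂ : |r₂| ≤ 2 * (g + 1) * ε * a ^ 2) :
    2 * (-(k * c ^ 2) - b * (c ^ 2 - h ^ 2 + g * d + r₁)) -
      2 * g * (b + k) * (d - h * l + g * a ^ 2 + r₂) ≤ 0 := by
  set M := 2 * g * (b + k) + 4 * b * (g + 1) + 4 * g * (b + k) * (g + 1) with hMdef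
  have hM : 0 < M := by positivity
  set m := min 1 (g ^ 2)
  have b1 : -(2 * b * r₁) ≤ 2 * b * (2 * (g + 1) * ε * (a * c)) := by
    nlinarith [neg_abs_le r₁]
  have b2 : -(2 * g * (b + k) * r₂) ≤ 2 * g * (b + k) * (2 * (g + 1) * ε * a ^ 2) := by
    rw [← mul_neg]
    gcongr
    exact (neg_le_abs _).trans hr₂
  have b3 : (2 * g * k - 2 * g * b) * (h * l) ≤ 2 * g * (b + k) * (ε * (a * c)) := by
    have h1 := (abs_le.1 hhl)
    have hgk : 0 ≤ 2 * g * k := by positivity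
    have hgb : 0 ≤ 2 * g * b := by positivity
    nlinarith
  have b4 : a * c ≤ a ^ 2 + c ^ 2 := by nlinarith [sq_nonneg (a - c), sq_nonneg a, sq_nonneg c]
  have b5 : m * (a ^ 2 + c ^ 2) ≤ c ^ 2 + g ^ 2 * a ^ 2 := by
    have h1 : m * a ^ 2 ≤ g ^ 2 * a ^ 2 := by gcongr; exact min_le_right _ _
    have h2 : m * c ^ 2 ≤ 1 * c ^ 2 := by gcongr; exact min_le_left _ _
    linarith
  have b6 : ε * M * (a ^ 2 + c ^ 2) ≤ k * (c ^ 2 + g ^ 2 * a ^ 2) := by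
    have h1 := mul_le_mul_of_nonneg_left b5 hk.le
    have h2 : 0 ≤ ε * M * (a ^ 2 + c ^ 2) := by positivity
    have h3 : k * (m * (a ^ 2 + c ^ 2)) = 2 * (ε * M * (a ^ 2 + c ^ 2)) := by
      rw [← mul_assoc, ← hεM]; ring
    linarith
  have b7 : 2 * g * (b + k) * (ε * (a * c)) + 2 * b * (2 * (g + 1) * ε * (a * c)) +
      2 * g * (b + k) * (2 * (g + 1) * ε * a ^ 2) ≤ ε * M * (a ^ 2 + c ^ 2) := by
    have h1 : (2 * g * (b + k) * ε + 2 * b * (2 * (g + 1) * ε)) * (a * c) ≤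
      (2 * g * (b + k) * ε + 2 * b * (2 * (g + 1) * ε)) * (a ^ 2 + c ^ 2) := by gcongr
    have h2 : 0 ≤ 2 * g * (b + k) * (2 * (g + 1) * ε * c ^ 2) := by positivity
    rw [hMdef]
    linarith
  -- Apart from `h * l`, `r₁` and `r₂`, the expression is `-2 b` times the first square, `-k` times
  -- the second, and `-k (c² + g² a²)`. The choice of `ε` makes the other terms at most half of a
  -- lower bound for `k (c² + g² a²)`.
  have b8 := mul_nonneg hb sq1
  have b9 := mul_nonneg hk.le sq2
  linarith

/-- Near the unstable equilibrium, the quadratic form `|δu|² - (B/2) |δγ|²` of the difference of two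
trajectories does not increase. -/
lemma exists_cone_deriv_nonpos (hg : 0 < g) (hk : 0 < k) (hb : 0 ≤ b) (hκ : 0 < κ) :
    ∃ ε > 0, ∀ x₁ x₂ y₁ y₂ : E, ‖x₁‖ = 1 → ‖x₂‖ = 1 →
    ‖x₁ + e‖ ≤ ε → ‖x₂ + e‖ ≤ ε → ‖y₁‖ ≤ ε →
    2 * ⟪y₁ - y₂, -(k • (y₁ - y₂)) - b • (slip g e x₁ y₁ - slip g e x₂ y₂)⟫ -
      2 * g * (b + k) / κ * ⟪x₁ - x₂, κ • (slip g e x₁ y₁ - slip g e x₂ y₂)⟫ ≤ 0 := by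
  set M := 2 * g * (b + k) + 4 * b * (g + 1) + 4 * g * (b + k) * (g + 1)
  have hM : 0 < M := by positivity
  set m := min 1 (g ^ 2)
  have hm : 0 < m := lt_min one_pos (by positivity)
  refine ⟨k * m / (2 * M), by positivity, fun x₁ x₂ y₁ y₂ hx₁ hx₂ hx₁e hx₂e hy₁ => ?_⟩
  set ε := k * m / (2 * M)
  have hε : 0 < ε := by positivity
  have hεM : 2 * (ε * M) = k * m := by simp only [ε]; field_simp
  set x := x₁ - x₂ with hxdef
  set y := y₁ - y₂ with hydef
  set a := ‖x‖
  set c := ‖y‖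
  have ha : 0 ≤ a := norm_nonneg _
  have hc : 0 ≤ c := norm_nonneg _
  have hle : ∀ p q : E, |⟪p, q⟫| ≤ ‖p‖ * ‖q‖ := abs_real_inner_le_norm
  -- the coefficients of the error term
  have hα : |⟪x₁, g • e + y₁⟫ + g| ≤ (g + 1) * ε := by
    have e1 : ⟪x₁, g • e + y₁⟫ + g = g * ⟪x₁, x₁ + e⟫ + ⟪x₁, y₁⟫ := by
      rw [inner_add_right, inner_add_right, real_inner_smul_right, inner_self_of_norm_one hx₁]
      ring
    rw [e1]
    have h1 := hle x₁ (x₁ + e)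
    have h2 := hle x₁ y₁
    rw [hx₁, one_mul] at h1 h2
    calc _ ≤ g * |⟪x₁, x₁ + e⟫| + |⟪x₁, y₁⟫| := by
          refine (abs_add_le _ _).trans ?_
          rw [abs_mul, abs_of_pos hg]
      _ ≤ g * ε + ε := by gcongr <;> linarith
      _ = _ := by ring
  have hxe : |⟪x, e⟫| ≤ ε * a := by
    -- For unit vectors `x₁ - x₂` is orthogonal to `x₁ + x₂`, so `e` may be replaced by a small
    -- vector.
    have e1 : ⟪x, e⟫ = ⟪x, (1 / 2 : ℝ) • ((x₁ + e) + (x₂ + e))⟫ := by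
      rw [hxdef]
      simp only [real_inner_smul_right, inner_add_right, inner_sub_left,
        inner_self_of_norm_one hx₁, inner_self_of_norm_one hx₂, real_inner_comm x₁ x₂]
      ring
    rw [e1]
    refine (hle _ _).trans ?_
    rw [mul_comm]
    gcongr
    rw [norm_smul]
    have := norm_add_le (x₁ + e) (x₂ + e)
    norm_num
    linarith
  have hβ : |⟪x, g • e + y₁⟫| ≤ (g + 1) * ε * a := by
    rw [inner_add_right, real_inner_smul_right]
    have h2 : |⟪x, y₁⟫| ≤ a * ε := (hle x y₁).trans (by gcongr)
    calc _ ≤ g * |⟪x, e⟫| + |⟪x, y₁⟫| := by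
          refine (abs_add_le _ _).trans ?_
          rw [abs_mul, abs_of_pos hg]
      _ ≤ g * (ε * a) + a * ε := by gcongr
      _ = _ := by ring
  have hl : |⟪x₂, x⟫| ≤ ε * a := by
    -- A chord of the sphere is tangent up to second order.
    have e1 : ⟪x₂, x⟫ = -(1 / 2) * ⟪x, x⟫ := by
      rw [hxdef]
      simp only [inner_sub_right, inner_sub_left,
        inner_self_of_norm_one hx₁, inner_self_of_norm_one hx₂, real_inner_comm x₁ x₂]
      ring
    have h2 : a ≤ ε + ε := by
      have e2 : x = (x₁ + e) - (x₂ + e) := by rw [hxdef]; abel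
      have := norm_sub_le (x₁ + e) (x₂ + e)
      rw [← e2] at this
      linarith
    rw [e1, real_inner_self_eq_norm_sq, abs_mul, abs_of_nonneg (sq_nonneg ‖x‖)]
    norm_num
    change 1 / 2 * a ^ 2 ≤ _
    nlinarith
  set α := ⟪x₁, g • e + y₁⟫ + g
  set β := ⟪x, g • e + y₁⟫
  set l := ⟪x₂, x⟫
  set h := ⟪x₂, y⟫
  have hh : |h| ≤ c := by
    have := hle x₂ y
    rwa [hx₂, one_mul] at this
  set rem : E := -(α • x) - β • x₂
  have hrem : ‖rem‖ ≤ 2 * (g + 1) * ε * a := by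
    refine (norm_sub_le _ _).trans ?_
    rw [norm_neg, norm_smul, norm_smul, hx₂, mul_one, Real.norm_eq_abs, Real.norm_eq_abs]
    have := mul_le_mul_of_nonneg_right hα ha
    change |α| * a + |β| ≤ _
    linarith
  have hs : slip g e x₁ y₁ - slip g e x₂ y₂ = y - h • x₂ + g • x + rem := by
    rw [slip_sub_slip]
    simp only [rem, α, β, h]
    module
  set r₁ := ⟪y, rem⟫
  set r₂ := ⟪x, rem⟫
  have hr₁ : |r₁| ≤ 2 * (g + 1) * ε * (a * c) :=
    (hle _ _).trans ((mul_le_mul_of_nonneg_left hrem hc).trans_eq (by ring))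
  have hr₂ : |r₂| ≤ 2 * (g + 1) * ε * a ^ 2 :=
    (hle _ _).trans ((mul_le_mul_of_nonneg_left hrem ha).trans_eq (by ring))
  set d := ⟪y, x⟫
  have hys : ⟪y, slip g e x₁ y₁ - slip g e x₂ y₂⟫ = c ^ 2 - h ^ 2 + g * d + r₁ := by
    rw [hs, inner_add_right, inner_add_right, inner_sub_right, real_inner_smul_right,
      real_inner_smul_right, real_inner_self_eq_norm_sq, real_inner_comm x₂ y]
    ring
  have hxs : ⟪x, slip g e x₁ y₁ - slip g e x₂ y₂⟫ = d - h * l + g * a ^ 2 + r₂ := by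
    rw [hs, inner_add_right, inner_add_right, inner_sub_right, real_inner_smul_right,
      real_inner_smul_right, real_inner_self_eq_norm_sq, real_inner_comm x₂ x, real_inner_comm y x]
  -- the squares
  have sq1 : 0 ≤ c ^ 2 - h ^ 2 + 2 * g * (d - h * l) + g ^ 2 * a ^ 2 := by
    have h1 : 0 ≤ ⟪y - h • x₂ + g • x, y - h • x₂ + g • x⟫ := real_inner_self_nonneg
    simp only [inner_add_right, inner_add_left, inner_sub_right, inner_sub_left,
      real_inner_smul_right, real_inner_smul_left, inner_self_of_norm_one hx₂,
      real_inner_comm x₂ x, real_inner_comm x₂ y, real_inner_comm y x] at h1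
    rw [real_inner_self_eq_norm_sq, real_inner_self_eq_norm_sq] at h1
    change 0 ≤ c ^ 2 - h * h + g * d - (h * h - h * (h * 1) + h * (g * l)) +
      (g * d - g * (h * l) + g * (g * a ^ 2)) at h1
    linarith
  have sq2 : 0 ≤ c ^ 2 + 2 * g * d + g ^ 2 * a ^ 2 := by
    have h1 : 0 ≤ ⟪y + g • x, y + g • x⟫ := real_inner_self_nonneg
    simp only [inner_add_right, inner_add_left,
      real_inner_smul_right, real_inner_smul_left, real_inner_comm y x] at h1
    rw [real_inner_self_eq_norm_sq, real_inner_self_eq_norm_sq] at h1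
    change 0 ≤ c ^ 2 + g * d + (g * d + g * (g * a ^ 2)) at h1
    linarith
  have hhl : |h * l| ≤ ε * (a * c) := by
    rw [abs_mul]
    calc |h| * |l| ≤ c * (ε * a) := by gcongr
      _ = _ := by ring
  rw [inner_sub_right, inner_neg_right, real_inner_smul_right, real_inner_smul_right,
    real_inner_smul_right, real_inner_self_eq_norm_sq, hys, hxs]
  change 2 * (-(k * c ^ 2) - b * (c ^ 2 - h ^ 2 + g * d + r₁)) -
    2 * g * (b + k) / κ * (κ * (d - h * l + g * a ^ 2 + r₂)) ≤ 0
  have e3 : 2 * g * (b + k) / κ * (κ * (d - h * l + g * a ^ 2 + r₂)) =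
    2 * g * (b + k) * (d - h * l + g * a ^ 2 + r₂) := by field_simp
  rw [e3]
  exact cone_form_nonpos hg hk hb hε hεM sq1 sq2 hhl hr₁ hr₂

namespace IsSphereFlow

variable {u₁ γ₁ u₂ γ₂ : ℝ → E} (h₁ : IsSphereFlow g k b κ e u₁ γ₁)
  (h₂ : IsSphereFlow g k b κ e u₂ γ₂)
include h₁ h₂

lemma hasDerivWithinAt_inner_sub_fst {t : ℝ} (ht : 0 ≤ t) :
    HasDerivWithinAt (fun s => ⟪u₁ s - u₂ s, u₁ s - u₂ s⟫)
      (2 * ⟪u₁ t - u₂ t, -(k • (u₁ t - u₂ t)) -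
        b • (slip g e (γ₁ t) (u₁ t) - slip g e (γ₂ t) (u₂ t))⟫) (Ici 0) t := by
  have hd := (h₁.deriv_fst t ht).sub (h₂.deriv_fst t ht)
  refine (hd.inner ℝ hd).congr_deriv ?_
  rw [real_inner_comm ((u₁ - u₂) t), ← two_mul]
  congr 2
  module

lemma hasDerivWithinAt_inner_sub_snd {t : ℝ} (ht : 0 ≤ t) :
    HasDerivWithinAt (fun s => ⟪γ₁ s - γ₂ s, γ₁ s - γ₂ s⟫)
      (2 * ⟪γ₁ t - γ₂ t, κ • (slip g e (γ₁ t) (u₁ t) - slip g e (γ₂ t) (u₂ t))⟫) (Ici 0) t := by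
  have hd := (h₁.deriv_snd t ht).sub (h₂.deriv_snd t ht)
  refine (hd.inner ℝ hd).congr_deriv ?_
  rw [real_inner_comm ((γ₁ - γ₂) t), ← two_mul]
  congr 2
  module

/-- Two trajectories neither separate nor approach each other faster than exponentially. -/
lemma sq_dist_le_exp (hg : 0 ≤ g) (hk : 0 ≤ k) (hb : 0 ≤ b) (hκ : 0 ≤ κ) (he : ‖e‖ = 1) {R : ℝ}
    (hR : ∀ t, 0 ≤ t → ‖u₁ t‖ ≤ R) {t : ℝ} (ht : 0 ≤ t) :
    ⟪u₁ t - u₂ t, u₁ t - u₂ t⟫ + ⟪γ₁ t - γ₂ t, γ₁ t - γ₂ t⟫ ≤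
      (⟪u₁ 0 - u₂ 0, u₁ 0 - u₂ 0⟫ + ⟪γ₁ 0 - γ₂ 0, γ₁ 0 - γ₂ 0⟫) *
        Real.exp ((2 * k + 8 * (b + κ) * (1 + (g + R))) * t) ∧
    ⟪u₁ 0 - u₂ 0, u₁ 0 - u₂ 0⟫ + ⟪γ₁ 0 - γ₂ 0, γ₁ 0 - γ₂ 0⟫ ≤
      (⟪u₁ t - u₂ t, u₁ t - u₂ t⟫ + ⟪γ₁ t - γ₂ t, γ₁ t - γ₂ t⟫) *
        Real.exp ((2 * k + 8 * (b + κ) * (1 + (g + R))) * t) := by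
  set K := 2 * k + 8 * (b + κ) * (1 + (g + R))
  have hd := fun r (hr : 0 ≤ r) =>
    (h₁.hasDerivWithinAt_inner_sub_fst h₂ hr).add (h₁.hasDerivWithinAt_inner_sub_snd h₂ hr)
  have habs := fun r (hr : 0 ≤ r) => abs_le.1 (abs_deriv_sq_dist_le he hg hk hb hκ
    (h₁.norm_eq r hr) (h₂.norm_eq r hr) (hR r hr) (y₂ := u₂ r))
  constructor
  · have := le_mul_exp_of_deriv_le (c := K) le_rfl hd (fun r hr => (habs r hr).2) ht
    simpa using this
  -- The lower bound on the derivative is the same comparison applied to the negated function.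
  · have := le_mul_exp_of_deriv_le (c := -K) le_rfl (fun r hr => (hd r hr).neg)
      (fun r hr => by
        have := (habs r hr).1
        simp only [Pi.neg_apply, Pi.add_apply]
        linarith) ht
    simp only [Pi.neg_apply, Pi.add_apply, sub_zero, neg_mul] at this
    have h3 := mul_le_mul_of_nonneg_right (neg_le_neg this) (Real.exp_pos (K * t)).le
    rw [neg_neg, neg_neg, mul_assoc, ← Real.exp_add] at h3
    simpa using h3

/-- Two trajectories that stay near the unstable equilibrium and converge to it differ mainly in the
velocity component. -/
lemma cone_of_tendsto {ε : ℝ} (hcone : ∀ x₁ x₂ y₁ y₂ : E, ‖x₁‖ = 1 → ‖x₂‖ = 1 →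
    ‖x₁ + e‖ ≤ ε → ‖x₂ + e‖ ≤ ε → ‖y₁‖ ≤ ε →
    2 * ⟪y₁ - y₂, -(k • (y₁ - y₂)) - b • (slip g e x₁ y₁ - slip g e x₂ y₂)⟫ -
      2 * g * (b + k) / κ * ⟪x₁ - x₂, κ • (slip g e x₁ y₁ - slip g e x₂ y₂)⟫ ≤ 0)
    {t₀ : ℝ} (ht₀ : 0 ≤ t₀) (hγ₁ : ∀ t, t₀ ≤ t → ‖γ₁ t + e‖ ≤ ε)
    (hγ₂ : ∀ t, t₀ ≤ t → ‖γ₂ t + e‖ ≤ ε) (hu₁ : ∀ t, t₀ ≤ t → ‖u₁ t‖ ≤ ε)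
    (hlu₁ : Tendsto u₁ atTop (𝓝 0)) (hlu₂ : Tendsto u₂ atTop (𝓝 0))
    (hlγ₁ : Tendsto γ₁ atTop (𝓝 (-e))) (hlγ₂ : Tendsto γ₂ atTop (𝓝 (-e))) :
    g * (b + k) / κ * ⟪γ₁ t₀ - γ₂ t₀, γ₁ t₀ - γ₂ t₀⟫ ≤ ⟪u₁ t₀ - u₂ t₀, u₁ t₀ - u₂ t₀⟫ := by
  have hlim : Tendsto (fun t => ⟪u₁ t - u₂ t, u₁ t - u₂ t⟫ -
      g * (b + k) / κ * ⟪γ₁ t - γ₂ t, γ₁ t - γ₂ t⟫) atTop (𝓝 0) := by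
    have h1 := hlu₁.sub hlu₂
    have h2 := hlγ₁.sub hlγ₂
    simpa using (h1.inner h1).sub ((h2.inner h2).const_mul (g * (b + k) / κ))
  rw [← sub_nonneg]
  -- The form is nonincreasing from `t₀` on and has limit `0`, hence is nonnegative at `t₀`.
  refine le_of_tendsto hlim ?_
  filter_upwards [eventually_ge_atTop t₀] with t ht
  refine le_of_deriv_nonpos (f := fun t => ⟪u₁ t - u₂ t, u₁ t - u₂ t⟫ -
      g * (b + k) / κ * ⟪γ₁ t - γ₂ t, γ₁ t - γ₂ t⟫) ht₀ (fun r hr =>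
    (h₁.hasDerivWithinAt_inner_sub_fst h₂ hr).sub
      ((h₁.hasDerivWithinAt_inner_sub_snd h₂ hr).const_mul _)) (fun r hr => ?_) ht
  have hr' := ht₀.trans hr
  refine le_trans (le_of_eq ?_) (hcone _ _ (u₁ r) (u₂ r) (h₁.norm_eq r hr') (h₂.norm_eq r hr')
    (hγ₁ r hr) (hγ₂ r hr) (hu₁ r hr))
  ring

end IsSphereFlow

/-- Global existence. -/
lemma IsSphereFlow.exists [FiniteDimensional ℝ E] (g k b κ : ℝ) (he : ‖e‖ = 1) (u₀ : E) {γ₀ : E}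
    (hγ₀ : ‖γ₀‖ = 1) :
    ∃ u γ : ℝ → E, IsSphereFlow g k b κ e u γ ∧ u 0 = u₀ ∧ γ 0 = γ₀ := by
  -- An extension of `slip` to all of `E × E`. It agrees with `slip` on unit vectors, the factor `2
  -- / (1 + |γ|²)` gives it linear growth, and orthogonality to `γ` keeps `|γ|` constant, so
  -- solutions starting on the sphere stay there.
  let σ : E × E → E := fun p =>
    (2 / (1 + ⟪p.2, p.2⟫)) • (⟪p.2, p.2⟫ • (g • e + p.1) - ⟪p.2, g • e + p.1⟫ • p.2)
  let f : E × E → E × E := fun p => (-(k • p.1) - b • σ p, κ • σ p)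
  have hpos : ∀ p : E × E, 0 < 1 + ⟪p.2, p.2⟫ := fun p =>
    add_pos_of_pos_of_nonneg one_pos real_inner_self_nonneg
  have hσ : ContDiff ℝ 1 σ := by
    have h1 : ContDiff ℝ 1 (fun p : E × E => ⟪p.2, p.2⟫) := contDiff_snd.inner ℝ contDiff_snd
    have h2 : ContDiff ℝ 1 (fun p : E × E => g • e + p.1) := contDiff_const.add contDiff_fst
    exact (contDiff_const.div (contDiff_const.add h1) fun p => (hpos p).ne').smul
      ((h1.smul h2).sub ((contDiff_snd.inner ℝ h2).smul contDiff_snd))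
  have hf : ContDiff ℝ 1 f :=
    ((contDiff_fst.const_smul k).neg.sub (hσ.const_smul b)).prodMk (hσ.const_smul κ)
  have hσb : ∀ p, ‖σ p‖ ≤ 4 * (|g| + 1) * (1 + ‖p‖) := by
    intro p
    have hw : ‖g • e + p.1‖ ≤ (|g| + 1) * (1 + ‖p‖) := by
      refine (norm_add_le _ _).trans ?_
      rw [norm_smul, he, mul_one, Real.norm_eq_abs]
      have := norm_fst_le p
      nlinarith [abs_nonneg g, norm_nonneg p]
    have h1 : ‖⟪p.2, p.2⟫ • (g • e + p.1) - ⟪p.2, g • e + p.1⟫ • p.2‖ ≤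
        2 * ‖p.2‖ ^ 2 * ‖g • e + p.1‖ := by
      refine (norm_sub_le _ _).trans ?_
      rw [norm_smul, norm_smul, real_inner_self_eq_norm_sq, norm_pow, norm_norm]
      have := mul_le_mul_of_nonneg_right (norm_inner_le_norm (𝕜 := ℝ) p.2 (g • e + p.1))
        (norm_nonneg p.2)
      linarith
    have h2 : ‖σ p‖ ≤ 4 * ‖g • e + p.1‖ := by
      simp only [σ]
      rw [norm_smul, Real.norm_of_nonneg (div_pos two_pos (hpos p)).le, div_mul_eq_mul_div,
        div_le_iff₀ (hpos p), real_inner_self_eq_norm_sq]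
      rw [real_inner_self_eq_norm_sq] at h1
      nlinarith [norm_nonneg (g • e + p.1)]
    linarith
  have hfb : ∀ p, ‖f p‖ ≤ (|k| + (|b| + |κ|) * (4 * (|g| + 1))) * (1 + ‖p‖) := by
    intro p
    have h1 := norm_fst_le p
    have h2 := hσb p
    have hp := norm_nonneg p
    refine norm_prod_le_iff.2 ⟨?_, ?_⟩
    · refine (norm_sub_le _ _).trans ?_
      rw [norm_neg, norm_smul, norm_smul, Real.norm_eq_abs, Real.norm_eq_abs]
      calc _ ≤ |k| * (1 + ‖p‖) + |b| * (4 * (|g| + 1) * (1 + ‖p‖)) := by gcongr; linarith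
        _ ≤ |k| * (1 + ‖p‖) + (|b| + |κ|) * (4 * (|g| + 1) * (1 + ‖p‖)) := by
          gcongr
          linarith [abs_nonneg κ]
        _ = _ := by ring
    · rw [norm_smul, Real.norm_eq_abs]
      calc _ ≤ |κ| * (4 * (|g| + 1) * (1 + ‖p‖)) := by gcongr
        _ ≤ |k| * (1 + ‖p‖) + (|b| + |κ|) * (4 * (|g| + 1) * (1 + ‖p‖)) := by
          have : 0 ≤ |k| * (1 + ‖p‖) + |b| * (4 * (|g| + 1) * (1 + ‖p‖)) := by positivity
          linarith
        _ = _ := by ring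
  obtain ⟨α, hα0, hα⟩ := exists_forall_hasDerivAt_of_linear_growth hf hfb (u₀, γ₀)
  have hfst : ∀ t, HasDerivAt (fun t => (α t).1) (f (α t)).1 t := fun t =>
    (ContinuousLinearMap.fst ℝ E E).hasFDerivAt.comp_hasDerivAt t (hα t)
  have hsnd : ∀ t, HasDerivAt (fun t => (α t).2) (f (α t)).2 t := fun t =>
    (ContinuousLinearMap.snd ℝ E E).hasFDerivAt.comp_hasDerivAt t (hα t)
  have horth : ∀ p : E × E, ⟪p.2, σ p⟫ = 0 := fun p => by
    simp only [σ, real_inner_smul_right, inner_sub_right]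
    ring
  have hconst : ∀ t, ⟪(α t).2, (α t).2⟫ = 1 := by
    intro t
    have hd : ∀ t, HasDerivAt (fun t => ⟪(α t).2, (α t).2⟫) 0 t := fun t => by
      refine ((hsnd t).inner ℝ (hsnd t)).congr_deriv ?_
      simp only [f]
      rw [real_inner_comm (α t).2, real_inner_smul_right, horth]
      ring
    rw [is_const_of_deriv_eq_zero (fun t => (hd t).differentiableAt) (fun t => (hd t).deriv) t 0,
      hα0]
    exact inner_self_of_norm_one hγ₀
  have hσs : ∀ t, σ (α t) = slip g e (α t).2 (α t).1 := fun t => by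
    simp only [σ, slip, hconst]
    norm_num
  refine ⟨fun t => (α t).1, fun t => (α t).2, ⟨fun t _ => ?_, fun t _ => ?_, fun t _ => ?_⟩,
    by simp [hα0], by simp [hα0]⟩
  · have := hconst t
    rw [real_inner_self_eq_norm_sq] at this
    exact (pow_eq_one_iff_of_nonneg (norm_nonneg _) two_ne_zero).1 this
  · have := (hfst t).hasDerivWithinAt (s := Ici 0)
    simp only [f, hσs] at this
    exact this
  · have := (hsnd t).hasDerivWithinAt (s := Ici 0)
    simp only [f, hσs] at this
    exact this

end SphereFlow

/-! ### Translation between the observer and the decoupled flow. -/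

lemma IsLocallyExponentiallyStablePt.isAsymptoticallyStablePt {X : Type*} [PseudoMetricSpace X]
    {S : Set (ℝ → X)} {p : X} (h : IsLocallyExponentiallyStablePt S p) :
    IsAsymptoticallyStablePt S p := by
  obtain ⟨r, hr, C, hC, a, ha, h⟩ := h
  refine ⟨fun ε hε => ⟨min r (ε / C), lt_min hr (by positivity), fun x hx hd t ht => ?_⟩,
    r, hr, fun x hx hd => ?_⟩
  · have h1 : dist (x 0) p * C < ε := (lt_div_iff₀ hC).1 (hd.trans_le (min_le_right _ _))
    have h2 : Real.exp (-a * t) ≤ 1 := Real.exp_le_one_iff.2 (by nlinarith)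
    calc _ ≤ C * dist (x 0) p * Real.exp (-a * t) :=
          h x hx (hd.trans_le (min_le_left _ _)) t ht
      _ ≤ C * dist (x 0) p * 1 := by gcongr
      _ < ε := by linarith
  · rw [tendsto_iff_dist_tendsto_zero]
    have hexp := (Real.tendsto_exp_atBot.comp
      (tendsto_id.const_mul_atTop_of_neg (neg_neg_of_pos ha))).const_mul (C * dist (x 0) p)
    rw [mul_zero] at hexp
    refine tendsto_of_tendsto_of_tendsto_of_le_of_le' tendsto_const_nhds hexp
      (Eventually.of_forall fun _ => dist_nonneg) ?_
    filter_upwards [eventually_ge_atTop 0] with t ht using h x hx hd t ht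

namespace GammaObserver

open scoped RealInnerProductSpace

lemma cross_cross (x v : E3) : cross x (cross x v) = ⟪x, v⟫ • x - ⟪x, x⟫ • v := by
  have h : ∀ a b : E3, ⟪a, b⟫ = a 0 * b 0 + a 1 * b 1 + a 2 * b 2 := fun a b => by
    simp [PiLp.inner_apply, Fin.sum_univ_three, mul_comm]
  rw [h, h]
  ext i
  fin_cases i <;> simp [cross, crossProduct] <;> ring

lemma norm_e3 : ‖e3‖ = 1 := by simp [e3]

lemma norm_snd (p : State) : ‖(p.2 : E3)‖ = 1 := by simp

/-- The velocity error in the coordinates of `IsSphereFlow`. -/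
noncomputable def slipVel (g k : ℝ) (p : State) : E3 := k • p.1 - g • (e3 - (p.2 : E3))

lemma continuous_slipVel (g k : ℝ) : Continuous (slipVel g k) := by
  unfold slipVel
  fun_prop

variable {g k1v k2v k1r : ℝ}

lemma fst_eq_of_slipVel (hk : k1v ≠ 0) (p : State) :
    p.1 = k1v⁻¹ • (slipVel g k1v p + g • (e3 - (p.2 : E3))) := by
  rw [slipVel, sub_add_cancel, smul_smul, inv_mul_cancel₀ hk, one_smul]

/-- Since `g e3 + u = k1v v + g γ`, the tangential part is `k1v` times that of `v`, and on the
sphere the double cross product is minus the tangential projection. -/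
lemma slip_slipVel (p : State) :
    slip g e3 p.2 (slipVel g k1v p) = -(k1v • cross p.2 (cross p.2 p.1)) := by
  have h1 : g • e3 + slipVel g k1v p = k1v • p.1 + g • (p.2 : E3) := by
    rw [slipVel]; module
  rw [slip, h1, cross_cross, inner_add_right, real_inner_smul_right, real_inner_smul_right,
    inner_self_of_norm_one (norm_snd p)]
  module

/-- The left side is the derivative of `u`. The first two terms of `fieldV` add up to `-u`; all the
rest is tangential, with net coefficient `k2v - g * k1r / k1v`. -/
lemma slipVel_deriv_eq (hk : k1v ≠ 0) (p : State) :
    k1v • fieldV g k1v k2v p + g • fieldG k1r p =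
      -(k1v • slipVel g k1v p) - (k2v - g * k1r / k1v) • slip g e3 p.2 (slipVel g k1v p) := by
  rw [slip_slipVel, fieldV, fieldG, slipVel]
  have : (k2v - g * k1r / k1v) * k1v = k1v * k2v - g * k1r := by field_simp
  rw [smul_neg (k2v - g * k1r / k1v), smul_smul (k2v - g * k1r / k1v), this]
  module

lemma fieldG_eq (hk : k1v ≠ 0) (p : State) :
    fieldG k1r p = (k1r / k1v) • slip g e3 p.2 (slipVel g k1v p) := by
  rw [slip_slipVel, fieldG, smul_neg, smul_smul, div_mul_cancel₀ _ hk]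

lemma fieldV_eq (hk : k1v ≠ 0) (p : State) :
    fieldV g k1v k2v p = k1v⁻¹ • (-(k1v • slipVel g k1v p) -
      (k2v - g * k1r / k1v) • slip g e3 p.2 (slipVel g k1v p) -
      g • ((k1r / k1v) • slip g e3 p.2 (slipVel g k1v p))) := by
  rw [← fieldG_eq hk, ← slipVel_deriv_eq hk, add_sub_cancel_right, smul_smul,
    inv_mul_cancel₀ hk, one_smul]

lemma isSphereFlow_of_mem (hk : k1v ≠ 0) {x : ℝ → State}
    (hx : x ∈ trajectories g k1v k2v k1r) :
    IsSphereFlow g k1v (k2v - g * k1r / k1v) (k1r / k1v) e3 (fun t => slipVel g k1v (x t))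
      (fun t => ((x t).2 : E3)) := by
  refine ⟨fun t _ => norm_snd _, fun t ht => ?_, fun t ht => ?_⟩
  · refine (((hx t ht).1.const_smul k1v).sub
      (((hx t ht).2.const_sub e3).const_smul g)).congr_deriv ?_
    rw [← slipVel_deriv_eq hk]
    module
  · exact (hx t ht).2.congr_deriv (fieldG_eq hk _)

lemma exists_trajectory (hk : k1v ≠ 0) (p : State) :
    ∃ x ∈ trajectories g k1v k2v k1r, x 0 = p := by
  obtain ⟨u, γ, h, hu, hγ⟩ := IsSphereFlow.exists g k1v (k2v - g * k1r / k1v) (k1r / k1v) norm_e3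
    (slipVel g k1v p) (norm_snd p)
  -- Trajectories take values in the state space at all real times, but `γ` is known to have norm
  -- one only for `t ≥ 0`; hence the truncation `max t 0`.
  let x : ℝ → State := fun t => (k1v⁻¹ • (u (max t 0) + g • (e3 - γ (max t 0))),
    ⟨γ (max t 0), by simpa using h.norm_eq _ (le_max_right t 0)⟩)
  have hx1 : ∀ t, 0 ≤ t → (x t).1 = k1v⁻¹ • (u t + g • (e3 - γ t)) := fun t ht => by
    simp only [x, max_eq_left ht]
  have hx2 : ∀ t, 0 ≤ t → ((x t).2 : E3) = γ t := fun t ht => by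
    simp only [x, max_eq_left ht]
  have hxu : ∀ t, 0 ≤ t → slipVel g k1v (x t) = u t := fun t ht => by
    rw [slipVel, hx1 t ht, hx2 t ht, smul_smul, mul_inv_cancel₀ hk, one_smul, add_sub_cancel_right]
  refine ⟨x, fun t ht => ⟨?_, ?_⟩, ?_⟩
  · rw [fieldV_eq (k1r := k1r) hk, hxu t ht, hx2 t ht]
    refine ((((h.deriv_fst t ht).add (((h.deriv_snd t ht).const_sub e3).const_smul g)).const_smul
      k1v⁻¹).congr_deriv ?_).congr (fun s hs => hx1 s hs) (hx1 t ht)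
    module
  · rw [fieldG_eq (g := g) hk, hxu t ht, hx2 t ht]
    exact (h.deriv_snd t ht).congr (fun s hs => hx2 s hs) (hx2 t ht)
  · refine Prod.ext ?_ (Subtype.ext ?_)
    · rw [hx1 0 le_rfl, hu, hγ, ← fst_eq_of_slipVel hk]
    · rw [hx2 0 le_rfl, hγ]

lemma dist_state (p q : State) : dist p q = max ‖p.1 - q.1‖ ‖(p.2 : E3) - q.2‖ := by
  rw [Prod.dist_eq, dist_eq_norm, Subtype.dist_eq, dist_eq_norm]

/-- Distances in the state space are controlled by those in the coordinates of `IsSphereFlow`. -/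
lemma dist_le_of_sq_le (hg : 0 < g) (hk : 0 < k1v) (p q : State) {D : ℝ} (hD : 0 ≤ D)
    (hu : ‖slipVel g k1v p - slipVel g k1v q‖ ≤ D) (hγ : ‖(p.2 : E3) - q.2‖ ≤ D) :
    dist p q ≤ (k1v⁻¹ * (1 + g) + 1) * D := by
  have hki : 0 < k1v⁻¹ := inv_pos.2 hk
  rw [dist_state]
  refine max_le ?_ (hγ.trans ?_)
  · have h1 : p.1 - q.1 = k1v⁻¹ • ((slipVel g k1v p - slipVel g k1v q) -
        g • ((p.2 : E3) - q.2)) := by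
      have h2 : (slipVel g k1v p - slipVel g k1v q) - g • ((p.2 : E3) - q.2) =
          k1v • (p.1 - q.1) := by
        simp only [slipVel]
        module
      rw [h2, smul_smul, inv_mul_cancel₀ hk.ne', one_smul]
    rw [h1, norm_smul, Real.norm_of_nonneg hki.le]
    have h2 := norm_sub_le (slipVel g k1v p - slipVel g k1v q) (g • ((p.2 : E3) - q.2))
    rw [norm_smul, Real.norm_of_nonneg hg.le] at h2
    have h3 : ‖slipVel g k1v p - slipVel g k1v q - g • ((p.2 : E3) - q.2)‖ ≤ (1 + g) * D := by
      nlinarith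
    calc _ ≤ k1v⁻¹ * ((1 + g) * D) := by gcongr
      _ ≤ _ := by linarith
  · have : 0 ≤ k1v⁻¹ * (1 + g) * D := by positivity
    linarith

@[simp] lemma slipVel_goodEq : slipVel g k1v goodEq = 0 := by simp [slipVel, goodEq, north]

lemma slipVel_badEq (hk : k1v ≠ 0) : slipVel g k1v (badEq g k1v) = 0 := by
  simp only [slipVel, badEq, north, smul_smul, mul_div_cancel₀ _ hk]
  change (2 * g) • e3 - g • (e3 - -e3) = 0
  module

lemma norm_sub_e3_sq (p : State) : ‖(p.2 : E3) - e3‖ ^ 2 = 2 * (1 - ⟪(p.2 : E3), e3⟫) := by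
  rw [norm_sub_sq_real, norm_snd, norm_e3]
  ring

lemma norm_add_e3_sq (p : State) : ‖(p.2 : E3) + e3‖ ^ 2 = 2 * (1 + ⟪(p.2 : E3), e3⟫) := by
  rw [norm_add_sq_real, norm_snd, norm_e3]
  ring

lemma goodEq_ne_badEq : goodEq ≠ badEq g k1v := by
  intro h
  have h1 : (north : E3) 2 = (-(north : E3)) 2 := congrArg (fun p : State => (p.2 : E3) 2) h
  norm_num [north, e3] at h1

lemma state_eq_of_slipVel (hk : k1v ≠ 0) {p q : State}
    (hu : slipVel g k1v p = slipVel g k1v q) (hγ : (p.2 : E3) = q.2) : p = q :=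
  Prod.ext (by rw [fst_eq_of_slipVel (g := g) hk p, hu, hγ, ← fst_eq_of_slipVel hk q])
    (Subtype.ext hγ)

lemma isEquilibrium_iff (hg : 0 < g) (hk : k1v ≠ 0) (hr : k1r ≠ 0) (p : State) :
    IsEquilibrium g k1v k2v k1r p ↔ p = goodEq ∨ p = badEq g k1v := by
  have hx := norm_snd p
  constructor
  · rintro ⟨hV, hG⟩
    rw [fieldG_eq (g := g) hk, smul_eq_zero_iff_right (div_ne_zero hr hk)] at hG
    rw [fieldV_eq (k1r := k1r) hk, hG, smul_zero, smul_zero, smul_zero, sub_zero, sub_zero,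
      smul_neg, neg_eq_zero, smul_smul, inv_mul_cancel₀ hk, one_smul] at hV
    -- With `u = 0`, the squared norm of `slip` is `g² (1 - ⟪γ, e3⟫²)`; its vanishing leaves only
    -- the two poles.
    have h1 := inner_slip_self norm_e3 hx g (slipVel g k1v p)
    rw [hG, hV] at h1
    simp only [inner_zero_left, inner_zero_right] at h1
    have h2 : (1 - ⟪(p.2 : E3), e3⟫) * (1 + ⟪(p.2 : E3), e3⟫) = 0 := by
      have : g ^ 2 * ((1 - ⟪(p.2 : E3), e3⟫) * (1 + ⟪(p.2 : E3), e3⟫)) = 0 := by linarith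
      exact (mul_eq_zero.1 this).resolve_left (by positivity)
    rcases mul_eq_zero.1 h2 with h | h
    · left
      refine state_eq_of_slipVel hk (hV.trans slipVel_goodEq.symm) ?_
      have := norm_sub_e3_sq p
      rw [h, mul_zero, sq_eq_zero_iff, norm_eq_zero, sub_eq_zero] at this
      exact this
    · right
      refine state_eq_of_slipVel hk (hV.trans (slipVel_badEq hk).symm) ?_
      have := norm_add_e3_sq p
      rw [h, mul_zero, sq_eq_zero_iff, norm_eq_zero] at this
      exact eq_neg_of_add_eq_zero_left this
  · have key : slipVel g k1v p = 0 → slip g e3 p.2 (slipVel g k1v p) = 0 →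
        IsEquilibrium g k1v k2v k1r p := fun h1 h2 =>
      ⟨by rw [fieldV_eq (k1r := k1r) hk, h2, h1]; simp, by rw [fieldG_eq (g := g) hk, h2, smul_zero]⟩
    rintro (rfl | rfl)
    · refine key slipVel_goodEq ?_
      rw [slipVel_goodEq]
      change slip g e3 e3 0 = 0
      simp [slip, real_inner_smul_right, norm_e3]
    · refine key (slipVel_badEq hk) ?_
      rw [slipVel_badEq hk]
      change slip g e3 (-e3) 0 = 0
      simp [slip, real_inner_smul_right, norm_e3]

/-! ### The energy and its comparison with the distance to the good equilibrium. -/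

/-- The Lyapunov function on the state space. -/
noncomputable def energy (g k1v k2v k1r : ℝ) (p : State) : ℝ :=
  lyap g k1v (k2v - g * k1r / k1v) (k1r / k1v) e3 (slipVel g k1v p) p.2

/-- The weight of the direction error in `energy`. -/
noncomputable def weight (g k1v k2v k1r : ℝ) : ℝ :=
  2 * g * (k2v - g * k1r / k1v + k1v) / (k1r / k1v)

lemma energy_eq (p : State) : energy g k1v k2v k1r p =
    ‖slipVel g k1v p‖ ^ 2 + weight g k1v k2v k1r * (1 - ⟪(p.2 : E3), e3⟫) := by
  rw [energy, lyap, weight, real_inner_self_eq_norm_sq]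

lemma energy_nonneg (hw : 0 < weight g k1v k2v k1r) (p : State) : 0 ≤ energy g k1v k2v k1r p := by
  rw [energy_eq]
  have := (inner_mem_Icc_of_norm_one (norm_snd p) norm_e3).2
  have : 0 ≤ 1 - ⟪(p.2 : E3), e3⟫ := by linarith
  positivity

lemma norm_slipVel_sq_le_energy (hw : 0 < weight g k1v k2v k1r) (p : State) :
    ‖slipVel g k1v p‖ ^ 2 ≤ energy g k1v k2v k1r p := by
  rw [energy_eq]
  have := (inner_mem_Icc_of_norm_one (norm_snd p) norm_e3).2
  have : 0 ≤ weight g k1v k2v k1r * (1 - ⟪(p.2 : E3), e3⟫) := mul_nonneg hw.le (by linarith)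
  linarith

lemma exists_dist_goodEq_le (hg : 0 < g) (hk : 0 < k1v) (hw : 0 < weight g k1v k2v k1r) :
    ∃ C > 0, ∀ p, dist p goodEq ≤ C * √(energy g k1v k2v k1r p) := by
  set B := weight g k1v k2v k1r
  have hki : 0 < k1v⁻¹ := inv_pos.2 hk
  refine ⟨(k1v⁻¹ * (1 + g) + 1) * √(1 + 2 / B), by positivity, fun p => ?_⟩
  rw [mul_assoc, ← Real.sqrt_mul (by positivity)]
  have hV := energy_nonneg hw p
  have h1 := norm_slipVel_sq_le_energy hw p
  refine dist_le_of_sq_le hg hk p goodEq (Real.sqrt_nonneg _) ?_ ?_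
  · rw [slipVel_goodEq, sub_zero]
    refine Real.le_sqrt_of_sq_le (h1.trans ?_)
    have : 0 ≤ 2 / B * energy g k1v k2v k1r p := by positivity
    linarith
  · refine Real.le_sqrt_of_sq_le ?_
    change ‖(p.2 : E3) - e3‖ ^ 2 ≤ _
    rw [norm_sub_e3_sq]
    have h2 : B * (1 - ⟪(p.2 : E3), e3⟫) ≤ energy g k1v k2v k1r p := by
      rw [energy_eq]
      have := sq_nonneg ‖slipVel g k1v p‖
      linarith
    have h3 : 2 / B * (B * (1 - ⟪(p.2 : E3), e3⟫)) = 2 * (1 - ⟪(p.2 : E3), e3⟫) := by field_simp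
    have h4 := mul_le_mul_of_nonneg_left h2 (by positivity : 0 ≤ 2 / B)
    linarith

lemma exists_energy_le_dist_sq (hg : 0 < g) (hk : 0 < k1v) (hw : 0 < weight g k1v k2v k1r) :
    ∃ C > 0, ∀ p, energy g k1v k2v k1r p ≤ C * dist p goodEq ^ 2 := by
  set B := weight g k1v k2v k1r
  refine ⟨(k1v + g) ^ 2 + B / 2, by positivity, fun p => ?_⟩
  have h0 := dist_state p goodEq
  have hv : ‖p.1‖ ≤ dist p goodEq := by
    rw [h0]
    refine le_trans (le_of_eq ?_) (le_max_left _ _)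
    simp [goodEq]
  have hγ : ‖(p.2 : E3) - e3‖ ≤ dist p goodEq := by
    rw [h0]
    exact le_max_right _ _
  set d := dist p goodEq
  have hd : 0 ≤ d := dist_nonneg
  have hu : ‖slipVel g k1v p‖ ≤ (k1v + g) * d := by
    refine (norm_sub_le _ _).trans ?_
    rw [norm_smul, norm_smul, Real.norm_of_nonneg hk.le, Real.norm_of_nonneg hg.le,
      norm_sub_rev e3]
    nlinarith
  have h1 : ‖slipVel g k1v p‖ ^ 2 ≤ ((k1v + g) * d) ^ 2 := by gcongr
  have h2 : ‖(p.2 : E3) - e3‖ ^ 2 ≤ d ^ 2 := by gcongr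
  rw [norm_sub_e3_sq] at h2
  rw [energy_eq]
  nlinarith

lemma energy_antitone (hk1v : 0 < k1v) (hk1r : 0 < k1r) (hb : 0 ≤ k2v - g * k1r / k1v)
    {x : ℝ → State} (hx : x ∈ trajectories g k1v k2v k1r) {s t : ℝ} (hs : 0 ≤ s) (hst : s ≤ t) : energy g k1v k2v k1r (x t) ≤ energy g k1v k2v k1r (x s) :=
  (isSphereFlow_of_mem hk1v.ne' hx).lyap_antitone hk1v.le hb (div_pos hk1r hk1v) norm_e3 hs hst

/-! ### Convergence, stability, the null exceptional set and instability. -/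

section Trajectories

variable (hg : 0 < g) (hk1v : 0 < k1v) (hk1r : 0 < k1r) (hb : 0 ≤ k2v - g * k1r / k1v)
include hg hk1v hk1r hb

lemma weight_pos : 0 < weight g k1v k2v k1r := by
  unfold weight
  positivity

lemma norm_slipVel_le {x : ℝ → State} (hx : x ∈ trajectories g k1v k2v k1r) {t : ℝ} (ht : 0 ≤ t) :
    ‖slipVel g k1v (x t)‖ ≤ √(energy g k1v k2v k1r (x 0)) :=
  Real.le_sqrt_of_sq_le ((norm_slipVel_sq_le_energy (weight_pos hg hk1v hk1r hb) _).trans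
    (energy_antitone hk1v hk1r hb hx le_rfl ht))

lemma tendsto_goodEq_of_energy_lt {x : ℝ → State} (hx : x ∈ trajectories g k1v k2v k1r) {t₀ : ℝ}
    (ht₀ : 0 ≤ t₀) (hlt : energy g k1v k2v k1r (x t₀) < 2 * weight g k1v k2v k1r) :
    Tendsto x atTop (𝓝 goodEq) := by
  have hw := weight_pos hg hk1v hk1r hb
  have hκ := div_pos hk1r hk1v
  set B := weight g k1v k2v k1r with hB
  -- This is the `η` for which the energy bound of `lyap_le_exp` holds with equality.
  set η := 2 - energy g k1v k2v k1r (x t₀) / B with hη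
  have hη0 : 0 < η := by
    rw [hη, sub_pos, div_lt_iff₀ hw]
    exact hlt
  have hdecay := fun t (ht : t₀ ≤ t) => (isSphereFlow_of_mem hk1v.ne' hx).lyap_le_exp hg hk1v hb
    hκ norm_e3 (η := η) ht₀ (by
      change energy g k1v k2v k1r (x t₀) ≤ B * (2 - η)
      rw [hη, sub_sub_cancel, mul_div_cancel₀ _ hw.ne']) ht
  change ∀ t, t₀ ≤ t → energy g k1v k2v k1r (x t) ≤ energy g k1v k2v k1r (x t₀) *
    Real.exp (-(k1v * min 1 (g ^ 2 * η / B)) * (t - t₀)) at hdecay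
  set c := k1v * min 1 (g ^ 2 * η / B)
  have hc : 0 < c := mul_pos hk1v (lt_min one_pos (by positivity))
  have hE : Tendsto (fun t => energy g k1v k2v k1r (x t)) atTop (𝓝 0) := by
    have hexp := (Real.tendsto_exp_atBot.comp
      ((tendsto_atTop_add_const_right atTop (-t₀) tendsto_id).const_mul_atTop_of_neg
        (neg_neg_of_pos hc))).const_mul (energy g k1v k2v k1r (x t₀))
    rw [mul_zero] at hexp
    refine tendsto_of_tendsto_of_tendsto_of_le_of_le' tendsto_const_nhds hexp
      (Eventually.of_forall fun t => energy_nonneg hw _) ?_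
    filter_upwards [eventually_ge_atTop t₀] with t ht using hdecay t ht
  obtain ⟨C, -, hC⟩ := exists_dist_goodEq_le hg hk1v hw
  rw [tendsto_iff_dist_tendsto_zero]
  have h1 : Tendsto (fun t => C * √(energy g k1v k2v k1r (x t))) atTop (𝓝 0) := by
    have := ((Real.continuous_sqrt.tendsto 0).comp hE).const_mul C
    rwa [Real.sqrt_zero, mul_zero] at this
  exact squeeze_zero (fun _ => dist_nonneg) (fun t => hC (x t)) h1

lemma tendsto_badEq_of_le_energy {x : ℝ → State} (hx : x ∈ trajectories g k1v k2v k1r)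
    (hle : ∀ t, 0 ≤ t → 2 * weight g k1v k2v k1r ≤ energy g k1v k2v k1r (x t)) :
    Tendsto x atTop (𝓝 (badEq g k1v)) := by
  obtain ⟨hU, hz⟩ := (isSphereFlow_of_mem hk1v.ne' hx).tendsto_of_le_lyap hg hk1v hb
    (div_pos hk1r hk1v) norm_e3 hle
  have h1 : Tendsto (fun t => ‖slipVel g k1v (x t)‖) atTop (𝓝 0) := by
    have := (Real.continuous_sqrt.tendsto 0).comp hU
    rw [Real.sqrt_zero] at this
    exact this.congr fun t => by
      simp only [Function.comp_apply]
      rw [real_inner_self_eq_norm_sq, Real.sqrt_sq (norm_nonneg _)]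
  have h2 : Tendsto (fun t => ‖((x t).2 : E3) + e3‖) atTop (𝓝 0) := by
    have := (Real.continuous_sqrt.tendsto 0).comp (by simpa using (hz.const_add 1).const_mul 2)
    rw [Real.sqrt_zero] at this
    exact this.congr fun t => by
      simp only [Function.comp_apply]
      rw [← norm_add_e3_sq, Real.sqrt_sq (norm_nonneg _)]
  rw [tendsto_iff_dist_tendsto_zero]
  have h3 := (h1.add h2).const_mul (k1v⁻¹ * (1 + g) + 1)
  rw [add_zero, mul_zero] at h3
  refine squeeze_zero (fun _ => dist_nonneg) (fun t => ?_) h3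
  refine dist_le_of_sq_le hg hk1v _ _ (by positivity) ?_ ?_
  · rw [slipVel_badEq hk1v.ne', sub_zero]
    exact le_add_of_nonneg_right (norm_nonneg _)
  · change ‖((x t).2 : E3) - -e3‖ ≤ _
    rw [sub_neg_eq_add]
    exact le_add_of_nonneg_left (norm_nonneg _)

lemma tendsto_goodEq_or_badEq {x : ℝ → State} (hx : x ∈ trajectories g k1v k2v k1r) :
    Tendsto x atTop (𝓝 goodEq) ∨ Tendsto x atTop (𝓝 (badEq g k1v)) := by
  by_cases h : ∃ t, 0 ≤ t ∧ energy g k1v k2v k1r (x t) < 2 * weight g k1v k2v k1r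
  · obtain ⟨t, ht, hlt⟩ := h
    exact Or.inl (tendsto_goodEq_of_energy_lt hg hk1v hk1r hb hx ht hlt)
  · push Not at h
    exact Or.inr (tendsto_badEq_of_le_energy hg hk1v hk1r hb hx h)

/-- Uniqueness is the Gronwall bound with zero initial distance; the bound `R` it needs comes from
the energy. -/
lemma eq_of_eq_zero {x y : ℝ → State} (hx : x ∈ trajectories g k1v k2v k1r)
    (hy : y ∈ trajectories g k1v k2v k1r) (h0 : y 0 = x 0) {t : ℝ} (ht : 0 ≤ t) : y t = x t := by
  have h := ((isSphereFlow_of_mem hk1v.ne' hy).sq_dist_le_exp (isSphereFlow_of_mem hk1v.ne' hx)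
    hg.le hk1v.le hb (div_pos hk1r hk1v).le norm_e3
    (fun t ht => norm_slipVel_le hg hk1v hk1r hb hy ht) ht).1
  simp only [h0, sub_self, inner_zero_left, add_zero, zero_mul] at h
  have h1 := real_inner_self_nonneg (x := slipVel g k1v (y t) - slipVel g k1v (x t))
  have h2 := real_inner_self_nonneg (x := ((y t).2 : E3) - (x t).2)
  refine state_eq_of_slipVel (g := g) hk1v.ne' (sub_eq_zero.1 ?_) (sub_eq_zero.1 ?_)
  · exact inner_self_eq_zero (𝕜 := ℝ).1 (by linarith)
  · exact inner_self_eq_zero (𝕜 := ℝ).1 (by linarith)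

lemma isLocallyExponentiallyStablePt_goodEq :
    IsLocallyExponentiallyStablePt (trajectories g k1v k2v k1r) goodEq := by
  have hw := weight_pos hg hk1v hk1r hb
  obtain ⟨C₁, hC₁, h₁⟩ := exists_dist_goodEq_le hg hk1v hw
  obtain ⟨C₂, hC₂, h₂⟩ := exists_energy_le_dist_sq hg hk1v hw
  set B := weight g k1v k2v k1r
  set c := k1v * min 1 (g ^ 2 * 1 / B)
  have hc : 0 < c := mul_pos hk1v (lt_min one_pos (by positivity))
  -- The radius forces the initial energy below `B`, half the critical level, so `η = 1`. Energy is
  -- quadratic in distance, so the rate is halved.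
  refine ⟨√(B / C₂), by positivity, C₁ * √C₂, by positivity, c / 2, by positivity,
    fun x hx hd t ht => ?_⟩
  have hd0 : 0 ≤ dist (x 0) goodEq := dist_nonneg
  have h3 : dist (x 0) goodEq ^ 2 ≤ B / C₂ := by
    have := (Real.lt_sqrt hd0).1 hd
    exact this.le
  have h4 : energy g k1v k2v k1r (x 0) ≤ B * (2 - 1) := by
    refine (h₂ _).trans ?_
    rw [le_div_iff₀ hC₂] at h3
    linarith
  have h5 := (isSphereFlow_of_mem hk1v.ne' hx).lyap_le_exp hg hk1v hb
    (div_pos hk1r hk1v) norm_e3 (η := 1) le_rfl h4 ht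
  change energy g k1v k2v k1r (x t) ≤ energy g k1v k2v k1r (x 0) *
    Real.exp (-c * (t - 0)) at h5
  have h6 : energy g k1v k2v k1r (x t) ≤
      C₂ * (dist (x 0) goodEq * Real.exp (-(c / 2) * t)) ^ 2 := by
    rw [mul_pow, ← Real.exp_nat_mul, ← mul_assoc]
    refine h5.trans ?_
    rw [show ((2 : ℕ) : ℝ) * (-(c / 2) * t) = -c * (t - 0) by push_cast; ring]
    gcongr
    exact h₂ _
  calc dist (x t) goodEq ≤ C₁ * √(energy g k1v k2v k1r (x t)) := h₁ _
    _ ≤ C₁ * √(C₂ * (dist (x 0) goodEq * Real.exp (-(c / 2) * t)) ^ 2) := by gcongr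
    _ = _ := by
      rw [Real.sqrt_mul hC₂.le, Real.sqrt_sq (by positivity)]
      ring

/-- The set of initial points of trajectories that converge to the unstable equilibrium is null. -/
lemma stateMeasure_tendsto_badEq : stateMeasure {p | ∃ x ∈ trajectories g k1v k2v k1r, x 0 = p ∧
    Tendsto x atTop (𝓝 (badEq g k1v))} = 0 := by
  have hκ := div_pos hk1r hk1v
  obtain ⟨ε, hε, hcone⟩ := exists_cone_deriv_nonpos (E := E3) (e := e3) hg hk1v hb hκ
  have hlim : ∀ x : ℝ → State, Tendsto x atTop (𝓝 (badEq g k1v)) →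
      Tendsto (fun t => slipVel g k1v (x t)) atTop (𝓝 0) ∧
      Tendsto (fun t => ((x t).2 : E3)) atTop (𝓝 (-e3)) := fun x hx => by
    refine ⟨?_, ?_⟩
    · have := ((continuous_slipVel g k1v).tendsto _).comp hx
      rwa [slipVel_badEq hk1v.ne'] at this
    · exact ((continuous_subtype_val.comp continuous_snd).tendsto (badEq g k1v)).comp hx
  -- One integer `n` bounds both the time after which the trajectory stays in the cone neighbourhood
  -- and the size of `u`, so that the constants are uniform on each piece.
  let P : ℕ → State → (ℝ → State) → Prop := fun n p x =>
    x ∈ trajectories g k1v k2v k1r ∧ x 0 = p ∧ Tendsto x atTop (𝓝 (badEq g k1v)) ∧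
      √(energy g k1v k2v k1r p) ≤ n ∧
      ∀ t, (n : ℝ) ≤ t → ‖slipVel g k1v (x t)‖ ≤ ε ∧ ‖((x t).2 : E3) + e3‖ ≤ ε
  refine measure_mono_null (t := ⋃ n, {p | ∃ x, P n p x}) ?_ (measure_iUnion_null fun n => ?_)
  · rintro p ⟨x, hx, h0, hbad⟩
    obtain ⟨hu, hγ⟩ := hlim x hbad
    have h1 : ∀ᶠ t in atTop, ‖slipVel g k1v (x t)‖ ≤ ε := by
      have := hu.norm
      rw [norm_zero] at this
      exact this.eventually (ge_mem_nhds hε)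
    have h2 : ∀ᶠ t in atTop, ‖((x t).2 : E3) + e3‖ ≤ ε := by
      have := (hγ.add_const e3).norm
      rw [neg_add_cancel, norm_zero] at this
      exact this.eventually (ge_mem_nhds hε)
    obtain ⟨a, ha⟩ := eventually_atTop.1 (h1.and h2)
    obtain ⟨n, hn⟩ := exists_nat_ge (max a (√(energy g k1v k2v k1r p)))
    exact mem_iUnion.2 ⟨n, x, hx, h0, hbad, (le_max_right _ _).trans hn,
      fun t ht => ha t (((le_max_left _ _).trans hn).trans ht)⟩
  · classical
    have hn : (0 : ℝ) ≤ n := n.cast_nonneg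
    set A := g * (k2v - g * k1r / k1v + k1v) / (k1r / k1v)
    have hA : 0 < A := by positivity
    set L := Real.exp ((2 * k1v + 8 * (k2v - g * k1r / k1v + k1r / k1v) * (1 + (g + n))) * n)
    have hki : 0 < k1v⁻¹ := inv_pos.2 hk1v
    refine stateMeasure_eq_zero_of_dist_le
      -- The chart sends an initial point to the value of `u` at time `n`. There the cone condition
      -- recovers `γ` from `u`, and the backward Gronwall factor `L` returns to time `0`.
      (fun p => if h : ∃ x, P n p x then slipVel g k1v (h.choose n) else 0)
      (Real.toNNReal ((k1v⁻¹ * (1 + g) + 1) * √((1 + 1 / A) * L))) ?_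
    intro p hp q hq
    rw [Real.coe_toNNReal _ (by positivity)]
    simp only [dif_pos (show ∃ x, P n p x from hp), dif_pos (show ∃ x, P n q x from hq)]
    obtain ⟨hx, hx0, hxbad, hxn, hxε⟩ := Exists.choose_spec hp
    obtain ⟨hy, hy0, hybad, hyn, hyε⟩ := Exists.choose_spec hq
    set x := Exists.choose hp
    set y := Exists.choose hq
    have hxf := isSphereFlow_of_mem hk1v.ne' hx
    have hyf := isSphereFlow_of_mem hk1v.ne' hy
    have h1 := hxf.cone_of_tendsto hyf hcone hn (fun t ht => (hxε t ht).2)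
      (fun t ht => (hyε t ht).2) (fun t ht => (hxε t ht).1) (hlim x hxbad).1 (hlim y hybad).1
      (hlim x hxbad).2 (hlim y hybad).2
    have h2 := (hxf.sq_dist_le_exp hyf hg.le hk1v.le hb hκ.le norm_e3 (R := n) (fun t ht => by
      refine (norm_slipVel_le hg hk1v hk1r hb hx ht).trans ?_
      rwa [hx0]) hn).2
    simp only [hx0, hy0, real_inner_self_eq_norm_sq] at h1 h2
    change A * _ ≤ _ at h1
    change _ ≤ _ * L at h2
    set δ := ‖slipVel g k1v (x n) - slipVel g k1v (y n)‖
    have h3 : ‖((x n).2 : E3) - (y n).2‖ ^ 2 ≤ 1 / A * δ ^ 2 := by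
      rw [div_mul_eq_mul_div, one_mul, le_div_iff₀ hA]
      linarith
    have hL : 0 < L := Real.exp_pos _
    have h4 : ‖slipVel g k1v p - slipVel g k1v q‖ ^ 2 + ‖(p.2 : E3) - q.2‖ ^ 2 ≤
        ((1 + 1 / A) * L) * δ ^ 2 := by
      refine h2.trans ?_
      calc _ ≤ (δ ^ 2 + 1 / A * δ ^ 2) * L := by gcongr
        _ = _ := by ring
    rw [dist_eq_norm]
    change dist p q ≤ _ * δ
    rw [mul_assoc]
    have h5 : √((1 + 1 / A) * L) * δ = √(((1 + 1 / A) * L) * δ ^ 2) := by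
      rw [Real.sqrt_mul (by positivity) (δ ^ 2), Real.sqrt_sq (norm_nonneg _)]
    rw [h5]
    refine dist_le_of_sq_le hg hk1v p q (Real.sqrt_nonneg _) ?_ ?_
    · exact Real.le_sqrt_of_sq_le (by linarith [sq_nonneg ‖(p.2 : E3) - q.2‖])
    · exact Real.le_sqrt_of_sq_le
        (by linarith [sq_nonneg ‖slipVel g k1v p - slipVel g k1v q‖])

lemma isAlmostGloballyAsymptoticallyStablePt_goodEq :
    IsAlmostGloballyAsymptoticallyStablePt stateMeasure (trajectories g k1v k2v k1r) goodEq := by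
  refine ⟨(isLocallyExponentiallyStablePt_goodEq hg hk1v hk1r hb).isAsymptoticallyStablePt, ?_⟩
  rw [ae_iff]
  refine measure_mono_null ?_ (stateMeasure_tendsto_badEq hg hk1v hk1r hb)
  intro p hp
  simp only [mem_ofPred_eq, not_forall] at hp
  obtain ⟨x, hx, h0, hn⟩ := hp
  exact ⟨x, hx, h0, (tendsto_goodEq_or_badEq hg hk1v hk1r hb hx).resolve_left hn⟩

/-- Arbitrarily close to the unstable equilibrium there are states of lower energy. -/
lemma exists_dist_badEq_lt {δ : ℝ} (hδ : 0 < δ) : ∃ p : State, dist p (badEq g k1v) < δ ∧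
    energy g k1v k2v k1r p < 2 * weight g k1v k2v k1r := by
  have hw := weight_pos hg hk1v hk1r hb
  let e1 : E3 := EuclideanSpace.single 0 1
  have he1 : ‖e1‖ = 1 := by simp [e1]
  have h13 : ⟪e1, e3⟫ = 0 := by
    simp [e1, e3, EuclideanSpace.inner_single_left]
  -- The direction is rotated away from `-e3` while `u = 0` is kept, so the energy is `B (1 + cos
  -- φ)`, which is below `2 B` for small `φ > 0`.
  let c : ℝ → E3 := fun φ => Real.sin φ • e1 - Real.cos φ • e3
  have hc : ∀ φ, ‖c φ‖ = 1 := fun φ => by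
    have : ‖c φ‖ ^ 2 = 1 := by
      rw [norm_sub_sq_real, norm_smul, norm_smul, he1, norm_e3, real_inner_smul_left,
        real_inner_smul_right, h13]
      simp
    exact (pow_eq_one_iff_of_nonneg (norm_nonneg _) two_ne_zero).1 this
  let p : ℝ → State := fun φ => (k1v⁻¹ • g • (e3 - c φ), ⟨c φ, by simpa using hc φ⟩)
  have hpu : ∀ φ, slipVel g k1v (p φ) = 0 := fun φ => by
    simp only [slipVel, p, smul_smul, mul_inv_cancel_left₀ hk1v.ne', sub_self]
  have hcont : Continuous p := by
    have : Continuous c := by fun_prop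
    exact Continuous.prodMk (by fun_prop) (this.subtype_mk _)
  have hp0 : p 0 = badEq g k1v := by
    refine state_eq_of_slipVel (g := g) hk1v.ne' ((hpu 0).trans (slipVel_badEq hk1v.ne').symm) ?_
    change c 0 = -e3
    simp [c]
  have h1 : ∀ᶠ φ in 𝓝[>] (0 : ℝ), dist (p φ) (badEq g k1v) < δ := by
    have := hcont.tendsto 0
    rw [hp0] at this
    exact nhdsWithin_le_nhds (this.eventually (Metric.ball_mem_nhds _ hδ))
  have h2 : ∀ᶠ φ in 𝓝[>] (0 : ℝ), φ ∈ Ioo 0 Real.pi := Ioo_mem_nhdsGT Real.pi_pos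
  obtain ⟨φ, hφ1, hφ2⟩ := (h1.and h2).exists
  refine ⟨p φ, hφ1, ?_⟩
  rw [energy_eq, hpu, norm_zero]
  have h3 : ⟪((p φ).2 : E3), e3⟫ = -Real.cos φ := by
    change ⟪Real.sin φ • e1 - Real.cos φ • e3, e3⟫ = _
    rw [inner_sub_left, real_inner_smul_left, real_inner_smul_left, h13,
      inner_self_of_norm_one norm_e3]
    ring
  have h4 : Real.cos φ < 1 := by
    rw [← Real.cos_zero]
    exact Real.cos_lt_cos_of_nonneg_of_le_pi le_rfl hφ2.2.le hφ2.1
  rw [h3]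
  nlinarith

/-- Trajectories from nearby states of lower energy converge to the good equilibrium, so they leave
the ball whose radius is half the distance between the equilibria. -/
lemma isUnstablePt_badEq : IsUnstablePt (trajectories g k1v k2v k1r) (badEq g k1v) := by
  intro h
  obtain ⟨δ, hδ, h⟩ := h (dist goodEq (badEq g k1v) / 2) (half_pos (dist_pos.2 goodEq_ne_badEq))
  obtain ⟨p, hp, hE⟩ := exists_dist_badEq_lt hg hk1v hk1r hb hδ
  obtain ⟨x, hx, rfl⟩ := exists_trajectory (g := g) (k2v := k2v) (k1r := k1r) hk1v.ne' p
  have hlim := tendsto_goodEq_of_energy_lt hg hk1v hk1r hb hx le_rfl hE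
  have hle := le_of_tendsto (hlim.dist (tendsto_const_nhds (x := badEq g k1v)))
    ((eventually_ge_atTop 0).mono fun t ht => (h x hx hp t ht).le)
  linarith [dist_pos.2 (goodEq_ne_badEq (g := g) (k1v := k1v))]

end Trajectories

end GammaObserver

theorem proposition1 (g k1v k2v k1r : ℝ) (hg : 0 < g) (hk1v : 0 < k1v) (hk2v : 0 < k2v)
    (hk1r : 0 < k1r) (hgain : k1r ≤ k1v * k2v / g) :
    -- exactly two equilibria, both isolated
    ((∀ p, GammaObserver.IsEquilibrium g k1v k2v k1r p ↔
        p = GammaObserver.goodEq ∨ p = GammaObserver.badEq g k1v) ∧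
      GammaObserver.goodEq ≠ GammaObserver.badEq g k1v ∧
      (∀ p, GammaObserver.IsEquilibrium g k1v k2v k1r p →
        ∀ᶠ q in nhds p, GammaObserver.IsEquilibrium g k1v k2v k1r q → q = p)) ∧
    -- every initial condition has exactly one forward trajectory
    (∀ p, ∃ x ∈ GammaObserver.trajectories g k1v k2v k1r, x 0 = p ∧
      ∀ y ∈ GammaObserver.trajectories g k1v k2v k1r, y 0 = p → ∀ t, 0 ≤ t → y t = x t) ∧
    -- every trajectory converges to one of the two equilibria
    (∀ x ∈ GammaObserver.trajectories g k1v k2v k1r,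
      Filter.Tendsto x Filter.atTop (nhds GammaObserver.goodEq) ∨
      Filter.Tendsto x Filter.atTop (nhds (GammaObserver.badEq g k1v))) ∧
    -- stability of the first equilibrium
    IsAlmostGloballyAsymptoticallyStablePt GammaObserver.stateMeasure
      (GammaObserver.trajectories g k1v k2v k1r) GammaObserver.goodEq ∧
    IsLocallyExponentiallyStablePt
      (GammaObserver.trajectories g k1v k2v k1r) GammaObserver.goodEq ∧
    -- instability of the second equilibrium
    IsUnstablePt (GammaObserver.trajectories g k1v k2v k1r) (GammaObserver.badEq g k1v) := by
  -- The gain condition, in the form that the Lyapunov and cone estimates need.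
  have hb : 0 ≤ k2v - g * k1r / k1v := by
    rw [sub_nonneg, div_le_iff₀ hk1v]
    rw [le_div_iff₀ hg] at hgain
    linarith
  have heq := GammaObserver.isEquilibrium_iff (k2v := k2v) hg hk1v.ne' hk1r.ne'
  refine ⟨⟨heq, GammaObserver.goodEq_ne_badEq, fun p hp => ?_⟩, fun p => ?_, fun x hx =>
    GammaObserver.tendsto_goodEq_or_badEq hg hk1v hk1r hb hx,
    GammaObserver.isAlmostGloballyAsymptoticallyStablePt_goodEq hg hk1v hk1r hb,
    GammaObserver.isLocallyExponentiallyStablePt_goodEq hg hk1v hk1r hb,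
    GammaObserver.isUnstablePt_badEq hg hk1v hk1r hb⟩
  · have hne := GammaObserver.goodEq_ne_badEq (g := g) (k1v := k1v)
    rcases (heq p).1 hp with rfl | rfl
    · filter_upwards [isOpen_ne.mem_nhds hne] with q hq hqe
      exact ((heq q).1 hqe).resolve_right hq
    · filter_upwards [isOpen_ne.mem_nhds hne.symm] with q hq hqe
      exact ((heq q).1 hqe).resolve_left hq
  · obtain ⟨x, hx, rfl⟩ := GammaObserver.exists_trajectory (g := g) (k2v := k2v) (k1r := k1r)
      hk1v.ne' p
    exact ⟨x, hx, rfl, fun y hy h0 t ht =>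
      GammaObserver.eq_of_eq_zero hg hk1v hk1r hb hx hy h0 ht⟩
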